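/- Let $\mathcal X$ be a finite set with $N\ge 1$ elements. Let $\mathcal R_N$ be the set of $N\times N$ Markov transition (row-stochastic) matrices $P$ on $\mathcal X$ that are reversible with respect to some probability distribution $\pi$ with $\pi(x)>0$ for all $x$ (that is, $\pi(x)P(x,y)=\pi(y)P(y,x)$ for all $x,y$), and let $\overline{\mathcal R_N}$ be its closure in $\mathbb R^{N^2}$. For probability distributions $\mu,\nu$ on $\mathcal X$ the separation distance is $$d_{\rm sep}(\mu,\nu)=\max_{x:\,\nu(x)>0}\Bigl[1-\frac{\mu(x)}{\nu(x)}\Bigr].$$ Let $P\in\overline{\mathcal R_N}$ be reversible with respect to a probability distribution $\pi$ on $\mathcal X$ (possibly with $\pi(x)=0$ for some $x$), and suppose that the eigenvalues of $P$, listed with algebraic multiplicity, are real and satisfy $0\le\beta_1\le\cdots\le\beta_{N-1}<\beta_N=1$. Let $\tau_1,\dots,\tau_{N-1}$ be independent geometric random variables with means $1/(1-\beta_j)$, i.e. $\mathbb P(\tau_j=t)=\beta_j^{t-1}(1-\beta_j)$ for $t\ge1$ (with $0^0=1$). Let $\mu$ be any probability distribution on $\mathcal X$. Then: (i) for every integer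 $t\ge0$, $$d_{\rm sep}(\mu P^t,\pi)\le\mathbb P(\tau_1+\cdots+\tau_{N-1}>t);$$ (ii) there are a probability space carrying a Markov chain $(X_t)_{t\ge0}$ with initial distribution $\mu$ and transition matrix $P$, and a strong stationary time $T$ for it with the same law as $\tau_1+\cdots+\tau_{N-1}$. Here $T$ is a strong stationary time if it is a randomized stopping time (a stopping time of a filtration relative to which $(X_t)$ is a Markov chain with transition matrix $P$) and $\mathbb P(X_T=x,\ T=t)=\pi(x)\,\mathbb P(T=t)$ for all $t\ge0$ and $x\in\mathcal X$. -/

import Mathlib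

open MeasureTheory ProbabilityTheory

noncomputable section

namespace MarkovSep

/-- Detailed balance: `π(x) P(x,y) = π(y) P(y,x)` for all `x`, `y`. -/
def IsReversible {S : Type*} (P : Matrix S S ℝ) (π : S → ℝ) : Prop :=
  ∀ x y, π x * P x y = π y * P y x

/-- Markov transition matrices on `S` that are reversible with respect to a probability
distribution charging every state. -/
def reversibleClass (S : Type*) [Fintype S] [DecidableEq S] : Set (Matrix S S ℝ) :=
  {P | P ∈ Matrix.rowStochastic ℝ S ∧
    ∃ π ∈ stdSimplex ℝ S, (∀ x, 0 < π x) ∧ IsReversible P π}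

/-- Separation distance `max_x [1 - μ(x)/ν(x)]`. States with `ν(x) = 0` do not contribute to
the maximum (the ratio is read as `+∞` there). The maximum is over a finite set, nonempty when `ν`
is a probability distribution. -/
def dsep {S : Type*} [Fintype S] (μ ν : S → ℝ) : ℝ :=
  ⨆ x : {x : S // ν x ≠ 0}, (1 - μ x / ν x)

/-- `X` is a Markov chain with initial distribution `μ` and transition matrix `P`, relative to
the filtration `ℱ` (which may be larger than the one generated by `X`). -/
structure IsMarkovChain {S Ω : Type*} [MeasurableSpace Ω] (ρ : Measure Ω)
    (ℱ : Filtration ℕ (inferInstance : MeasurableSpace Ω))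
    (μ : S → ℝ) (P : Matrix S S ℝ) (X : ℕ → Ω → S) : Prop where
  adapted : ∀ t x, MeasurableSet[ℱ t] {ω | X t ω = x}
  initial : ∀ x, ρ.real {ω | X 0 ω = x} = μ x
  markov : ∀ t x y A, MeasurableSet[ℱ t] A →
    ρ.real (A ∩ {ω | X t ω = x ∧ X (t + 1) ω = y}) =
      ρ.real (A ∩ {ω | X t ω = x}) * P x y

/-- `τ` is a (finite) strong stationary time for the chain `X`: a randomized stopping time, i.e.
a stopping time of the filtration `ℱ` relative to which `X` is Markov, with
`Prob(X_τ = x | τ = t) = π(x)` for every `x` and every `t` (written without division). -/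
structure IsStrongStationaryTime {S Ω : Type*} [MeasurableSpace Ω] (ρ : Measure Ω)
    (ℱ : Filtration ℕ (inferInstance : MeasurableSpace Ω))
    (π : S → ℝ) (X : ℕ → Ω → S) (τ : Ω → ℕ) : Prop where
  stopping : IsStoppingTime ℱ (fun ω => (τ ω : WithTop ℕ))
  stationary : ∀ t x,
    ρ.real {ω | X (τ ω) ω = x ∧ τ ω = t} = π x * ρ.real {ω | τ ω = t}

end MarkovSep

end

/-!
For a reversible kernel, Cauchy interlacing of the eigenvalues of principal submatrices makes the
divided differences of resolvent entries nonnegative; this is the theorem of Micchelli and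
Willoughby that `∏ (P - β j)`, taken over the smallest eigenvalues, is entrywise nonnegative. It
passes to the closure because the eigenvalues stay in a compact set. Hence the normalized products
`μ ∏ (P - β j) / (1 - β j)` are probability measures, the last of which is `π`, and they intertwine
`P` with a pure-birth chain whose holding probabilities are the `β j`. The absorption time of the
birth chain is `τ = ∑ τ j`, so `P(τ ≤ t) π ≤ μ P ^ t`: this is the separation bound. Conversely,
such a domination lets one stop the chain at `x` at time `t` with conditional probability
`P(τ = t) π(x)` divided by the mass still unstopped there, which gives a strong stationary time
with the law of `τ`.
-/

open Polynomial Matrix Lagrange Finset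

noncomputable section

namespace MarkovSep

section NewtonBasis

/-- The Newton polynomials `∏ i < d, (X - a i)` of a sequence of nodes, as a basis of `ℝ[X]`. -/
def newtonBasis (a : ℕ → ℝ) : Module.Basis ℕ ℝ ℝ[X] :=
  Polynomial.Sequence.basis
    ⟨fun d => nodal (range d) a, fun d => by rw [degree_nodal, card_range]⟩
    fun d => (nodal_monic (s := range d) (v := a)).leadingCoeff ▸ isUnit_one

lemma newtonBasis_apply (a : ℕ → ℝ) (d : ℕ) : newtonBasis a d = nodal (range d) a :=
  Polynomial.Sequence.basis_eq_self _ _ _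

lemma nodal_range_succ {R : Type*} [CommRing R] (a : ℕ → R) (d : ℕ) :
    nodal (range (d + 1)) a = nodal (range d) a * (X - C (a d)) :=
  prod_range_succ _ _

/-- The polynomials of degree at most `d` with nonnegative coefficients in the Newton basis. -/
def newtonCone (a : ℕ → ℝ) (d : ℕ) : PointedCone ℝ ℝ[X] :=
  PointedCone.hull ℝ ((fun e => nodal (range e) a) '' Set.Iic d)

lemma newtonCone_mono (a : ℕ → ℝ) : Monotone (newtonCone a) := fun _ _ h =>
  Submodule.span_mono (Set.image_mono (Set.Iic_subset_Iic.2 h))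

lemma C_mul_mem_newtonCone {a : ℕ → ℝ} {d : ℕ} {c : ℝ} {p : ℝ[X]} (hc : 0 ≤ c)
    (hp : p ∈ newtonCone a d) : C c * p ∈ newtonCone a d := by
  rw [← smul_eq_C_mul]
  exact (newtonCone a d).smul_mem hc hp

lemma newtonBasis_repr_nonneg {a : ℕ → ℝ} {d : ℕ} {p : ℝ[X]} (hp : p ∈ newtonCone a d) (e : ℕ) :
    0 ≤ (newtonBasis a).repr p e := by
  induction hp using Submodule.span_induction with
  | mem p hp =>
    obtain ⟨f, -, rfl⟩ := hp
    simp only [← newtonBasis_apply, Module.Basis.repr_self, Finsupp.single_apply]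
    split_ifs <;> simp
  | zero => simp
  | add p q _ _ hp hq => simpa using add_nonneg hp hq
  | smul c p _ hp =>
    rw [← Nonneg.coe_smul, map_smul]
    exact mul_nonneg c.2 hp

lemma nonneg_of_sum_mem_newtonCone {a c : ℕ → ℝ} {d : ℕ} {s : Finset ℕ}
    (h : ∑ e ∈ s, C (c e) * nodal (range e) a ∈ newtonCone a d) {e : ℕ} (he : e ∈ s) :
    0 ≤ c e := by
  have hrepr : (newtonBasis a).repr (∑ e ∈ s, C (c e) * nodal (range e) a) e = c e := by
    simp [← smul_eq_C_mul, ← newtonBasis_apply, Finsupp.single_apply, he]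
  exact hrepr ▸ newtonBasis_repr_nonneg h e

lemma mul_X_sub_C_mem_newtonCone {a : ℕ → ℝ} {d : ℕ} {c : ℝ} (hc : ∀ e ≤ d, c ≤ a e) {p : ℝ[X]}
    (hp : p ∈ newtonCone a d) : p * (X - C c) ∈ newtonCone a (d + 1) := by
  induction hp using Submodule.span_induction with
  | mem p hp =>
    obtain ⟨e, he, rfl⟩ := hp
    have hmem : ∀ f ≤ d + 1, nodal (range f) a ∈ newtonCone a (d + 1) := fun f hf =>
      Submodule.subset_span ⟨f, hf, rfl⟩
    have hsplit : nodal (range e) a * (X - C c) =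
        nodal (range (e + 1)) a + C (a e - c) * nodal (range e) a := by
      rw [nodal_range_succ, C_sub]
      ring
    change nodal (range e) a * (X - C c) ∈ newtonCone a (d + 1)
    rw [hsplit]
    exact add_mem (hmem _ (Nat.succ_le_succ he))
      (C_mul_mem_newtonCone (sub_nonneg.2 (hc e he)) (hmem _ (Nat.le_succ_of_le he)))
  | zero => simp
  | add p q _ _ hp hq => simpa only [add_mul] using add_mem hp hq
  | smul r p _ hp => simpa only [smul_mul_assoc] using Submodule.smul_mem _ r hp

lemma nodal_mem_newtonCone {a b : ℕ → ℝ} {d : ℕ} (h : ∀ e i, e ≤ i → i < d → b i ≤ a e) :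
    nodal (range d) b ∈ newtonCone a d := by
  induction d with
  | zero => exact Submodule.subset_span ⟨0, Set.mem_Iic.2 le_rfl, by simp⟩
  | succ d ih =>
    rw [nodal_range_succ]
    exact mul_X_sub_C_mem_newtonCone (fun e he => h e d he d.lt_succ_self)
      (ih fun e i hei hi => h e i hei (hi.trans d.lt_succ_self))

end NewtonBasis

section Adjugate

variable {R n : Type*} [CommRing R] [Fintype n] [DecidableEq n]

/-- Dividing `M.charpoly` by `X - M` one Newton node at a time gives the adjugate. -/
lemma adjugate_charmatrix_apply (M : Matrix n n R) {a : ℕ → R} {N : ℕ}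
    (hM : M.charpoly = nodal (range N) a) (i j : n) :
    (charmatrix M).adjugate i j =
      ∑ d ∈ range N, C (aeval M (nodal (Ico (d + 1) N) a) i j) * nodal (range d) a := by
  set W : ℕ → Matrix n n R := fun d => aeval M (nodal (Ico d N) a) with hW
  set Q : Matrix n n R[X] := ∑ d ∈ range N, nodal (range d) a • C.mapMatrix (W (d + 1)) with hQ
  have W_zero : W 0 = 0 := by rw [hW, ← aeval_self_charpoly M, hM, range_eq_Ico]
  have W_last : W N = 1 := by simp [hW]
  have W_eq : ∀ d < N, W d = M * W (d + 1) - a d • W (d + 1) := fun d hd => by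
    have : nodal (Ico d N) a = (X - C (a d)) * nodal (Ico (d + 1) N) a :=
      prod_eq_prod_Ico_succ_bot hd _
    simp only [hW, this, map_mul, map_sub, aeval_X, aeval_C, sub_mul, Algebra.smul_def]
  have telescope : ∀ d < N, charmatrix M * (nodal (range d) a • C.mapMatrix (W (d + 1))) =
      nodal (range (d + 1)) a • C.mapMatrix (W (d + 1)) -
        nodal (range d) a • C.mapMatrix (W d) := fun d hd => by
    rw [W_eq d hd, map_sub, map_mul, charmatrix, sub_mul, nodal_range_succ]
    ext1 p q
    simp only [mul_smul_comm, Matrix.sub_apply, Matrix.smul_apply, Matrix.scalar_apply,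
      Matrix.diagonal_mul, RingHom.mapMatrix_apply, Matrix.map_apply, smul_eq_mul, map_mul]
    ring
  have charmatrix_mul : charmatrix M * Q = M.charpoly • 1 := by
    rw [hQ, mul_sum, sum_congr rfl fun d hd => telescope d (mem_range.1 hd),
      sum_range_sub (fun d => nodal (range d) a • C.mapMatrix (W d)), W_zero, W_last, hM]
    simp
  have smul_eq : M.charpoly • Q = M.charpoly • (charmatrix M).adjugate := by
    rw [← mul_one (charmatrix M).adjugate, ← mul_smul_comm, ← charmatrix_mul, ← mul_assoc,
      adjugate_mul, smul_one_mul, Matrix.charpoly]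
  have Q_eq : Q i j = (charmatrix M).adjugate i j :=
    M.charpoly_monic.isRegular.left (congrFun₂ smul_eq i j)
  rw [← Q_eq, hQ, Matrix.sum_apply]
  exact sum_congr rfl fun d _ => by simp [mul_comm, hW]

lemma charmatrix_submatrix {m : Type*} [Fintype m] [DecidableEq m] (M : Matrix n n R) {f : m → n}
    (hf : Function.Injective f) : charmatrix (M.submatrix f f) = (charmatrix M).submatrix f f := by
  ext1 p q
  simp [charmatrix_apply, diagonal_apply, hf.eq_iff]

variable {k : ℕ} (M : Matrix (Fin (k + 1)) (Fin (k + 1)) R) (j : Fin (k + 1))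

lemma adjugate_charmatrix_self :
    (charmatrix M).adjugate j j = (M.submatrix j.succAbove j.succAbove).charpoly := by
  rw [adjugate_fin_succ_eq_det_submatrix, Matrix.charpoly,
    charmatrix_submatrix M Fin.succAbove_right_injective, ← two_mul, pow_mul, neg_one_sq, one_pow,
    one_mul]

lemma adjugate_charmatrix_succAbove (i : Fin k) :
    (charmatrix M).adjugate (j.succAbove i) j =
      ∑ l, (charmatrix (M.submatrix j.succAbove j.succAbove)).adjugate i l *
        C (M (j.succAbove l) j) := by
  set B := M.submatrix j.succAbove j.succAbove with hB
  set col : Fin k → R[X] := fun l => C (M (j.succAbove l) j)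
  set adjCol : Fin k → R[X] := fun l => (charmatrix M).adjugate (j.succAbove l) j
  have charmatrix_mulVec : charmatrix B *ᵥ adjCol = B.charpoly • col := by
    ext1 l
    have hne : j.succAbove l ≠ j := Fin.succAbove_ne j l
    have hentry := congrFun₂ (mul_adjugate (charmatrix M)) (j.succAbove l) j
    rw [Matrix.mul_apply, Fin.sum_univ_succAbove _ j, adjugate_charmatrix_self,
      charmatrix_apply_ne _ _ _ hne, Matrix.smul_apply, one_apply_ne hne, smul_zero] at hentry
    simp only [hB, charmatrix_submatrix M Fin.succAbove_right_injective, mulVec, dotProduct,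
      submatrix_apply, Pi.smul_apply, smul_eq_mul, adjCol, col]
    linear_combination hentry
  have smul_eq : B.charpoly • adjCol = B.charpoly • ((charmatrix B).adjugate *ᵥ col) := by
    rw [← mulVec_smul, ← charmatrix_mulVec, mulVec_mulVec, adjugate_mul, smul_mulVec, one_mulVec,
      Matrix.charpoly]
  exact B.charpoly_monic.isRegular.left (congrFun smul_eq i)

end Adjugate

section Interlacing

variable {n m : Type*} [Fintype n] [Fintype m]

lemma mulVec_dotProduct_mulVec_mulVec {R : Type*} [CommSemiring R] (E : Matrix n m R)
    (A : Matrix n n R) (x : m → R) : (E *ᵥ x) ⬝ᵥ A *ᵥ (E *ᵥ x) = x ⬝ᵥ (Eᵀ * A * E) *ᵥ x := by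
  rw [← mulVec_mulVec, ← mulVec_mulVec, dotProduct_mulVec x, vecMul_transpose]

variable [DecidableEq n] [DecidableEq m] {M : Matrix n n ℝ}

/-- The coordinates of a vector in an orthonormal eigenbasis of a symmetric matrix. -/
def eigencoord (hM : M.IsHermitian) : (n → ℝ) →ₗ[ℝ] (n → ℝ) :=
  (hM.eigenvectorUnitary : Matrix n n ℝ)ᵀ.mulVecLin

lemma dotProduct_self_eq_sum_eigencoord (hM : M.IsHermitian) (x : n → ℝ) :
    x ⬝ᵥ x = ∑ l, eigencoord hM x l ^ 2 := by
  set U := (hM.eigenvectorUnitary : Matrix n n ℝ)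
  have orthogonal : U * Uᵀ = 1 := Unitary.coe_mul_star_self hM.eigenvectorUnitary
  calc x ⬝ᵥ x = (Uᵀ *ᵥ x) ⬝ᵥ 1 *ᵥ (Uᵀ *ᵥ x) := by
        rw [mulVec_dotProduct_mulVec_mulVec, mul_one, transpose_transpose, orthogonal, one_mulVec]
    _ = ∑ l, eigencoord hM x l ^ 2 := by
        rw [one_mulVec]
        exact sum_congr rfl fun l _ => (sq _).symm

lemma dotProduct_mulVec_eq_sum_eigencoord (hM : M.IsHermitian) (x : n → ℝ) :
    x ⬝ᵥ M *ᵥ x = ∑ l, hM.eigenvalues l * eigencoord hM x l ^ 2 := by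
  set U := (hM.eigenvectorUnitary : Matrix n n ℝ)
  have spectral : M = U * diagonal hM.eigenvalues * Uᵀ := hM.spectral_theorem
  calc x ⬝ᵥ M *ᵥ x = (Uᵀ *ᵥ x) ⬝ᵥ diagonal hM.eigenvalues *ᵥ (Uᵀ *ᵥ x) := by
        rw [mulVec_dotProduct_mulVec_mulVec, transpose_transpose, ← spectral]
    _ = ∑ l, hM.eigenvalues l * eigencoord hM x l ^ 2 :=
        sum_congr rfl fun l _ => by
          rw [mulVec_diagonal, eigencoord, mulVecLin_apply]
          ring

lemma dotProduct_mulVec_le_of_eigencoord_eq_zero (hM : M.IsHermitian) {c : ℝ} {x : n → ℝ}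
    (hx : ∀ l, c < hM.eigenvalues l → eigencoord hM x l = 0) : x ⬝ᵥ M *ᵥ x ≤ c * (x ⬝ᵥ x) := by
  rw [dotProduct_mulVec_eq_sum_eigencoord hM, dotProduct_self_eq_sum_eigencoord hM, mul_sum]
  refine sum_le_sum fun l _ => ?_
  rcases lt_or_ge c (hM.eigenvalues l) with hl | hl
  · simp [hx l hl]
  · exact mul_le_mul_of_nonneg_right hl (sq_nonneg _)

lemma le_dotProduct_mulVec_of_eigencoord_eq_zero (hM : M.IsHermitian) {c : ℝ} {x : n → ℝ}
    (hx : ∀ l, hM.eigenvalues l < c → eigencoord hM x l = 0) : c * (x ⬝ᵥ x) ≤ x ⬝ᵥ M *ᵥ x := by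
  rw [dotProduct_mulVec_eq_sum_eigencoord hM, dotProduct_self_eq_sum_eigencoord hM, mul_sum]
  refine sum_le_sum fun l _ => ?_
  rcases lt_or_ge (hM.eigenvalues l) c with hl | hl
  · simp [hx l hl]
  · exact mul_le_mul_of_nonneg_right hl (sq_nonneg _)

lemma roots_nodal {R ι : Type*} [CommRing R] [IsDomain R] (s : Finset ι) (v : ι → R) :
    (nodal s v).roots = s.val.map v := by
  rw [nodal, prod_eq_multiset_prod, ← roots_multiset_prod_X_sub_C (s.val.map v), Multiset.map_map]
  rfl

lemma card_eigenvalues_eq_card_filter (hM : M.IsHermitian) {a : ℕ → ℝ} {N : ℕ}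
    (h : M.charpoly = nodal (range N) a) (p : ℝ → Prop) [DecidablePred p] :
    Fintype.card {l // p (hM.eigenvalues l)} = #{k ∈ range N | p (a k)} := by
  have hroots : univ.val.map hM.eigenvalues = (range N).val.map a := by
    rw [← roots_nodal (range N), ← h, hM.roots_charpoly_eq_eigenvalues]
    rfl
  have := congrArg (Multiset.countP p) hroots
  rwa [Multiset.countP_map, Multiset.countP_map, ← filter_val, ← filter_val, card_val, card_val,
    ← Fintype.card_subtype] at this

lemma card_eigenvalues_gt_le (hM : M.IsHermitian) {a : ℕ → ℝ} {N : ℕ}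
    (ha : AntitoneOn a (Set.Iio N)) (h : M.charpoly = nodal (range N) a) (i : ℕ) :
    Fintype.card {l // a i < hM.eigenvalues l} ≤ i := by
  rw [card_eigenvalues_eq_card_filter hM h (a i < ·)]
  refine (card_le_card fun k hk => ?_).trans_eq (card_range i)
  rw [mem_filter, mem_range] at hk
  by_contra hki
  rw [mem_range, not_lt] at hki
  exact hk.2.not_ge (ha (hki.trans_lt hk.1) hk.1 hki)

lemma card_eigenvalues_lt_le (hM : M.IsHermitian) {a : ℕ → ℝ} {N : ℕ}
    (ha : AntitoneOn a (Set.Iio N)) (h : M.charpoly = nodal (range N) a) {i : ℕ} (hi : i < N) :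
    Fintype.card {l // hM.eigenvalues l < a i} ≤ N - (i + 1) := by
  rw [card_eigenvalues_eq_card_filter hM h (· < a i), ← Nat.card_Ico]
  refine card_le_card fun k hk => ?_
  rw [mem_filter, mem_range] at hk
  refine mem_Ico.2 ⟨Nat.lt_of_not_ge fun hki => ?_, hk.1⟩
  exact hk.2.not_ge (ha hk.1 hi hki)

lemma exists_ne_zero_eigencoord_eq_zero (hM : M.IsHermitian) {B : Matrix m m ℝ}
    (hB : B.IsHermitian) (E : Matrix n m ℝ) (p q : ℝ → Prop)
    [DecidablePred p] [DecidablePred q]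
    (hcard : Fintype.card {l // p (hB.eigenvalues l)} + Fintype.card {l // q (hM.eigenvalues l)} <
      Fintype.card m) :
    ∃ x ≠ 0, (∀ l, p (hB.eigenvalues l) → eigencoord hB x l = 0) ∧
      ∀ l, q (hM.eigenvalues l) → eigencoord hM (E *ᵥ x) l = 0 := by
  let Φ : (m → ℝ) →ₗ[ℝ] ({l // p (hB.eigenvalues l)} → ℝ) × ({l // q (hM.eigenvalues l)} → ℝ) :=
    (LinearMap.funLeft ℝ ℝ Subtype.val ∘ₗ eigencoord hB).prod
      (LinearMap.funLeft ℝ ℝ Subtype.val ∘ₗ eigencoord hM ∘ₗ E.mulVecLin)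
  have hker : Φ.ker ≠ ⊥ := LinearMap.ker_ne_bot_of_finrank_lt <| by
    simpa only [Module.finrank_prod, Module.finrank_fintype_fun_eq_card] using hcard
  obtain ⟨x, hx, hx0⟩ := Submodule.exists_mem_ne_zero_of_ne_bot hker
  exact ⟨x, hx0, fun l hl => congrFun (congrArg Prod.fst hx) ⟨l, hl⟩,
    fun l hl => congrFun (congrArg Prod.snd hx) ⟨l, hl⟩⟩

/-- A vector spanned by the top eigenvectors of the compression whose image is spanned by the
bottom eigenvectors of `M` exists for dimension reasons; compare its two Rayleigh quotients. -/
theorem eigenvalue_compression_le (hM : M.IsHermitian) {E : Matrix n m ℝ} (hE : Eᵀ * E = 1)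
    {a b : ℕ → ℝ} {N K : ℕ} (ha : AntitoneOn a (Set.Iio N)) (hb : AntitoneOn b (Set.Iio K))
    (hMa : M.charpoly = nodal (range N) a) (hMb : (Eᵀ * M * E).charpoly = nodal (range K) b)
    {i : ℕ} (hi : i < K) : b i ≤ a i := by
  have hB : (Eᵀ * M * E).IsHermitian := isHermitian_conjTranspose_mul_mul E hM
  have hK : Fintype.card m = K := by
    rw [← (Eᵀ * M * E).charpoly_natDegree_eq_dim, hMb, natDegree_nodal, card_range]
  obtain ⟨x, hx0, hxB, hxM⟩ := exists_ne_zero_eigencoord_eq_zero hM hB E (· < b i) (a i < ·) <| by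
    have hlt := card_eigenvalues_lt_le hB hb hMb hi
    have hgt := card_eigenvalues_gt_le hM ha hMa i
    omega
  have hlower := le_dotProduct_mulVec_of_eigencoord_eq_zero hB hxB
  have hupper := dotProduct_mulVec_le_of_eigencoord_eq_zero hM hxM
  have hnorm : (E *ᵥ x) ⬝ᵥ (E *ᵥ x) = x ⬝ᵥ x := by
    simpa only [one_mulVec, Matrix.mul_one, hE] using mulVec_dotProduct_mulVec_mulVec E 1 x
  have hpos : 0 < x ⬝ᵥ x := dotProduct_self_star_pos_iff.2 hx0
  rw [hnorm, mulVec_dotProduct_mulVec_mulVec] at hupper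
  exact le_of_mul_le_mul_right (hlower.trans hupper) hpos

lemma exists_antitoneOn_charpoly_eq_nodal (hM : M.IsHermitian) :
    ∃ a : ℕ → ℝ, AntitoneOn a (Set.Iio (Fintype.card n)) ∧
      M.charpoly = nodal (range (Fintype.card n)) a := by
  set a : ℕ → ℝ := fun k => if h : k < Fintype.card n then hM.eigenvalues₀ ⟨k, h⟩ else 0
  have a_fin : ∀ k : Fin (Fintype.card n), a k = hM.eigenvalues₀ k := fun k => dif_pos k.2
  refine ⟨a, fun i hi k hk hik => ?_, ?_⟩
  · simpa only [← a_fin] using hM.eigenvalues₀_antitone (a := ⟨i, hi⟩) (b := ⟨k, hk⟩) hik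
  · rw [hM.charpoly_eq, nodal, ← Fin.prod_univ_eq_prod_range (fun k => X - C (a k))]
    simp only [a_fin]
    exact Equiv.prod_comp _ (fun k => X - C (hM.eigenvalues₀ k))

end Interlacing

section MicchelliWilloughby

lemma one_submatrix_transpose_mul_mul {R n m : Type*} [CommSemiring R] [Fintype n] [DecidableEq n]
    (M : Matrix n n R) (f : m → n) :
    ((1 : Matrix n n R).submatrix id f)ᵀ * M * (1 : Matrix n n R).submatrix id f =
      M.submatrix f f := by
  ext i j
  simp [transpose_submatrix, Matrix.mul_apply, one_apply]

theorem eigenvalue_submatrix_le {n m : Type*} [Fintype n] [DecidableEq n] [Fintype m]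
    [DecidableEq m] {M : Matrix n n ℝ} (hM : M.IsHermitian) {f : m → n}
    (hf : Function.Injective f) {a b : ℕ → ℝ} {N K : ℕ} (ha : AntitoneOn a (Set.Iio N))
    (hb : AntitoneOn b (Set.Iio K)) (hMa : M.charpoly = nodal (range N) a)
    (hMb : (M.submatrix f f).charpoly = nodal (range K) b) {i : ℕ} (hi : i < K) : b i ≤ a i := by
  refine eigenvalue_compression_le hM (E := (1 : Matrix n n ℝ).submatrix id f) ?_ ha hb hMa ?_ hi
  · have := one_submatrix_transpose_mul_mul (1 : Matrix n n ℝ) f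
    rwa [Matrix.mul_one, submatrix_one f hf] at this
  · rwa [one_submatrix_transpose_mul_mul]

/-- The entries expand nonnegatively in the Newton polynomials at the nodes `b`, and domination
`b i ≤ a i` turns these into nonnegative combinations of those at the nodes `a`. -/
lemma adjugate_charmatrix_mem_newtonCone {k : ℕ} {M : Matrix (Fin (k + 1)) (Fin (k + 1)) ℝ}
    (hM₀ : ∀ i j, 0 ≤ M i j) {a b : ℕ → ℝ} (ha : AntitoneOn a (Set.Iio (k + 1)))
    (hab : ∀ i < k, b i ≤ a i) {j : Fin (k + 1)}
    (hb : (M.submatrix j.succAbove j.succAbove).charpoly = nodal (range k) b)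
    (hB₀ : ∀ d p q,
      0 ≤ aeval (M.submatrix j.succAbove j.succAbove) (nodal (Ico d k) b) p q)
    (i : Fin (k + 1)) : (charmatrix M).adjugate i j ∈ newtonCone a k := by
  have nodal_mem : ∀ d ≤ k, nodal (range d) b ∈ newtonCone a k := fun d hd =>
    newtonCone_mono a hd <| nodal_mem_newtonCone fun e i hei hi =>
      (hab i (hi.trans_le hd)).trans <| ha (Set.mem_Iio.2 (by omega)) (Set.mem_Iio.2 (by omega)) hei
  rcases Fin.eq_self_or_eq_succAbove j i with rfl | ⟨p, rfl⟩
  · rw [adjugate_charmatrix_self, hb]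
    exact nodal_mem k le_rfl
  · rw [adjugate_charmatrix_succAbove]
    refine sum_mem fun q _ => ?_
    rw [mul_comm, adjugate_charmatrix_apply _ hb]
    exact C_mul_mem_newtonCone (hM₀ _ _) <| sum_mem fun d hd =>
      C_mul_mem_newtonCone (hB₀ _ _ _) (nodal_mem d (mem_range.1 hd).le)

theorem aeval_nodal_Ico_nonneg {N : ℕ} {M : Matrix (Fin N) (Fin N) ℝ} (hM : M.IsHermitian)
    (hM₀ : ∀ i j, 0 ≤ M i j) {a : ℕ → ℝ} (ha : AntitoneOn a (Set.Iio N))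
    (hMa : M.charpoly = nodal (range N) a) (d : ℕ) (i j : Fin N) :
    0 ≤ aeval M (nodal (Ico d N) a) i j := by
  induction N generalizing a d with
  | zero => exact i.elim0
  | succ k ih =>
    have hB : (M.submatrix j.succAbove j.succAbove).IsHermitian := hM.submatrix _
    obtain ⟨b, hb, hBb⟩ := exists_antitoneOn_charpoly_eq_nodal hB
    rw [Fintype.card_fin] at hb hBb
    have hab : ∀ i < k, b i ≤ a i := fun i =>
      eigenvalue_submatrix_le hM Fin.succAbove_right_injective ha hb hMa hBb
    have hmem := adjugate_charmatrix_mem_newtonCone hM₀ ha hab hBb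
      (fun d p q => ih hB (fun _ _ => hM₀ _ _) hb hBb d p q) i
    rw [adjugate_charmatrix_apply M hMa] at hmem
    rcases d with _ | d
    · rw [← range_eq_Ico, ← hMa, aeval_self_charpoly, Matrix.zero_apply]
    · rcases lt_or_ge d (k + 1) with hd | hd
      · exact nonneg_of_sum_mem_newtonCone hmem (mem_range.2 hd)
      · rw [Ico_eq_empty_of_le (hd.trans d.le_succ), nodal_empty, map_one, one_apply]
        exact ite_nonneg zero_le_one le_rfl

/-- The conclusion of the Micchelli–Willoughby theorem: the eigenvalues of `M` are real, and, listed
in decreasing order as `a 0 ≥ a 1 ≥ ⋯`, they make every product `∏ i ≥ d, (M - a i)` entrywise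
nonnegative. The sequence `a` is only meaningful below `Fintype.card S`. -/
def IsMicchelliWilloughby {S : Type*} [Fintype S] [DecidableEq S] (M : Matrix S S ℝ) : Prop :=
  ∃ a : ℕ → ℝ, AntitoneOn a (Set.Iio (Fintype.card S)) ∧
    M.charpoly = nodal (range (Fintype.card S)) a ∧
    ∀ d x y, 0 ≤ aeval M (nodal (Ico d (Fintype.card S)) a) x y

variable {S : Type*} [Fintype S] [DecidableEq S]

theorem isMicchelliWilloughby_of_isHermitian {M : Matrix S S ℝ} (hM : M.IsHermitian)
    (hM₀ : ∀ x y, 0 ≤ M x y) : IsMicchelliWilloughby M := by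
  obtain ⟨a, ha, hMa⟩ := exists_antitoneOn_charpoly_eq_nodal hM
  refine ⟨a, ha, hMa, fun d x y => ?_⟩
  let e := Fintype.equivFin S
  have hnonneg := aeval_nodal_Ico_nonneg (M := reindexAlgEquiv ℝ ℝ e M) (hM.submatrix _)
    (fun _ _ => hM₀ _ _) ha ((charpoly_reindex e M).trans hMa) d (e x) (e y)
  rw [aeval_algHom_apply (reindexAlgEquiv ℝ ℝ e)] at hnonneg
  simpa using hnonneg

end MicchelliWilloughby

section ReversibleClass

variable {S : Type*} [Fintype S] [DecidableEq S]

lemma semiconjBy_aeval {R A : Type*} [CommSemiring R] [Semiring A] [Algebra R A] {d p m : A}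
    (h : SemiconjBy d p m) (f : R[X]) : SemiconjBy d (aeval p f) (aeval m f) := by
  induction f using Polynomial.induction_on' with
  | add f g hf hg => simpa only [map_add] using hf.add_right hg
  | monomial k c =>
    simpa only [aeval_monomial] using
      SemiconjBy.mul_right (Algebra.commutes c d).symm (h.pow_right k)

lemma IsMicchelliWilloughby.of_diagonal_conj {P M : Matrix S S ℝ} {s : S → ℝ} (hs : ∀ x, 0 < s x)
    (hPM : diagonal s * P * diagonal s⁻¹ = M) (hM : IsMicchelliWilloughby M) :
    IsMicchelliWilloughby P := by
  obtain ⟨a, ha, hMa, hnonneg⟩ := hM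
  have inv_mul : diagonal s⁻¹ * diagonal s = 1 := by
    rw [diagonal_mul_diagonal, ← diagonal_one]
    exact congrArg _ <| funext fun x => inv_mul_cancel₀ (hs x).ne'
  refine ⟨a, ha, ?_, fun d x y => ?_⟩
  · rw [← hMa, ← hPM, charpoly_mul_comm, ← mul_assoc, inv_mul, one_mul]
  · have semiconj : SemiconjBy (diagonal s) P M := by
      rw [SemiconjBy, ← hPM, mul_assoc _ _ (diagonal s), inv_mul, mul_one]
    have hentry := congrFun₂ (semiconjBy_aeval semiconj (nodal (Ico d (Fintype.card S)) a)) x y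
    rw [diagonal_mul, mul_diagonal] at hentry
    exact nonneg_of_mul_nonneg_right (hentry ▸ mul_nonneg (hnonneg d x y) (hs y).le) (hs x)

lemma IsReversible.isHermitian_diagonal_sqrt_conj {P : Matrix S S ℝ} {π : S → ℝ}
    (h : IsReversible P π) (hπ : ∀ x, 0 < π x) :
    (diagonal (fun x => √(π x)) * P * diagonal (fun x => √(π x))⁻¹).IsHermitian := by
  refine IsHermitian.ext fun x y => ?_
  have hx := (Real.sqrt_pos.2 (hπ x)).ne'
  have hy := (Real.sqrt_pos.2 (hπ y)).ne'
  simp only [mul_diagonal, diagonal_mul, Pi.inv_apply, star_trivial]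
  field_simp
  rw [Real.sq_sqrt (hπ x).le, Real.sq_sqrt (hπ y).le, h]

theorem isMicchelliWilloughby_of_mem_reversibleClass {P : Matrix S S ℝ}
    (hP : P ∈ reversibleClass S) : IsMicchelliWilloughby P := by
  obtain ⟨hstoch, π, -, hπ, hrev⟩ := hP
  refine .of_diagonal_conj (fun x => Real.sqrt_pos.2 (hπ x)) rfl <|
    isMicchelliWilloughby_of_isHermitian (hrev.isHermitian_diagonal_sqrt_conj hπ) fun x y => ?_
  rw [mul_diagonal, diagonal_mul]
  exact mul_nonneg (mul_nonneg (Real.sqrt_nonneg _) (hstoch.1 x y))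
    (inv_nonneg.2 (Real.sqrt_nonneg _))

lemma mem_Icc_of_isRoot_charpoly {P : Matrix S S ℝ} (hP : P ∈ rowStochastic ℝ S) {r : ℝ}
    (hr : P.charpoly.IsRoot r) : r ∈ Set.Icc (-1) 1 := by
  have heigen : Module.End.HasEigenvalue (toLin' P) r := by
    rwa [Module.End.hasEigenvalue_iff_isRoot_charpoly, charpoly_toLin']
  obtain ⟨x, hx⟩ := eigenvalue_mem_ball heigen
  have radius_eq : ∑ y ∈ univ.erase x, ‖P x y‖ = 1 - P x x := by
    rw [← sum_row_of_mem_rowStochastic hP x, ← add_sum_erase _ _ (mem_univ x), add_sub_cancel_left]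
    exact sum_congr rfl fun y _ => Real.norm_of_nonneg (hP.1 x y)
  rw [radius_eq, Metric.mem_closedBall, Real.dist_eq, abs_le] at hx
  have hdiag := hP.1 x x
  constructor <;> linarith [hx.1, hx.2]

lemma continuous_aeval_nodal {R A ι Y : Type*} [CommRing R] [Ring A] [Algebra R A]
    [TopologicalSpace R] [TopologicalSpace A] [IsTopologicalRing A] [ContinuousSMul R A]
    [TopologicalSpace Y] {v : Y → ι → R} {M : Y → A} (hv : ∀ i, Continuous fun y => v y i)
    (hM : Continuous M) (s : Finset ι) : Continuous fun y => aeval (M y) (nodal s (v y)) := by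
  classical
  induction s using Finset.induction_on with
  | empty => simpa only [nodal_empty, map_one] using continuous_const
  | insert i s hi ih =>
    simp only [nodal_insert_eq_nodal hi, map_mul, map_sub, aeval_X, aeval_C,
      Algebra.algebraMap_eq_smul_one]
    exact (hM.sub ((hv i).smul continuous_const)).mul ih

lemma isClosed_setOf_charpoly_eq_nodal_and_aeval_nonneg (N : ℕ) :
    IsClosed {p : (ℕ → ℝ) × Matrix S S ℝ | AntitoneOn p.1 (Set.Iio N) ∧
      p.2.charpoly = nodal (range N) p.1 ∧ ∀ d x y, 0 ≤ aeval p.2 (nodal (Ico d N) p.1) x y} := by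
  have continuous_coord : ∀ i, Continuous fun p : (ℕ → ℝ) × Matrix S S ℝ => p.1 i := fun i =>
    (continuous_apply i).comp continuous_fst
  have charpoly_eq_iff : ∀ p : (ℕ → ℝ) × Matrix S S ℝ, p.2.charpoly = nodal (range N) p.1 ↔
      ∀ z, (scalar S z - p.2).det = ∏ i ∈ range N, (z - p.1 i) := fun p => by
    simp only [← eval_charpoly, ← eval_nodal]
    exact ⟨fun h z => h ▸ rfl, Polynomial.funext⟩
  have antitone_closed :
      IsClosed {p : (ℕ → ℝ) × Matrix S S ℝ | AntitoneOn p.1 (Set.Iio N)} := by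
    simp only [AntitoneOn, Set.ofPred_forall]
    exact isClosed_iInter fun i => isClosed_iInter fun _ => isClosed_iInter fun k =>
      isClosed_iInter fun _ => isClosed_iInter fun _ =>
        isClosed_le (continuous_coord k) (continuous_coord i)
  have charpoly_closed :
      IsClosed {p : (ℕ → ℝ) × Matrix S S ℝ | p.2.charpoly = nodal (range N) p.1} := by
    simp only [charpoly_eq_iff, Set.ofPred_forall]
    exact isClosed_iInter fun z => isClosed_eq (continuous_const.sub continuous_snd).matrix_det
      (continuous_finsetProd _ fun i _ => continuous_const.sub (continuous_coord i))
  have nonneg_closed : IsClosed {p : (ℕ → ℝ) × Matrix S S ℝ |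
      ∀ d x y, 0 ≤ aeval p.2 (nodal (Ico d N) p.1) x y} := by
    simp only [Set.ofPred_forall]
    exact isClosed_iInter fun d => isClosed_iInter fun x => isClosed_iInter fun y =>
      isClosed_le continuous_const <|
        (continuous_aeval_nodal continuous_coord continuous_snd _).matrix_elem x y
  exact antitone_closed.inter (charpoly_closed.inter nonneg_closed)

lemma isClosed_setOf_isMicchelliWilloughby_of_bounded {l u : ℝ} (hlu : l ≤ u) :
    IsClosed {M : Matrix S S ℝ | IsMicchelliWilloughby M ∧
      ∀ z, M.charpoly.IsRoot z → z ∈ Set.Icc l u} := by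
  set N := Fintype.card S
  -- The eigenvalues range over a compact space, so projecting them away is a closed map.
  let K : Set ((ℕ → Set.Icc l u) × Matrix S S ℝ) :=
    (fun p => (fun i => (p.1 i : ℝ), p.2)) ⁻¹'
      {p | AntitoneOn p.1 (Set.Iio N) ∧ p.2.charpoly = nodal (range N) p.1 ∧
        ∀ d x y, 0 ≤ aeval p.2 (nodal (Ico d N) p.1) x y}
  have hK : IsClosed K :=
    (isClosed_setOf_charpoly_eq_nodal_and_aeval_nonneg (S := S) N).preimage <|
      (continuous_pi fun i => continuous_subtype_val.comp
        ((continuous_apply i).comp continuous_fst)).prodMk continuous_snd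
  convert isClosedMap_snd_of_compactSpace K hK using 1
  ext M
  constructor
  · rintro ⟨⟨a, ha, hMa, hnonneg⟩, hroot⟩
    have mem_Icc : ∀ i ∈ range N, a i ∈ Set.Icc l u := fun i hi =>
      hroot _ <| by rw [hMa, IsRoot, eval_nodal_at_node hi]
    let b : ℕ → Set.Icc l u := fun i => Set.projIcc l u hlu (a i)
    have b_eq : ∀ i ∈ range N, (b i : ℝ) = a i := fun i hi =>
      congrArg Subtype.val (Set.projIcc_of_mem hlu (mem_Icc i hi))
    have nodal_eq : ∀ s ⊆ range N, nodal s (fun i => (b i : ℝ)) = nodal s a := fun s hs =>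
      prod_congr rfl fun i hi => by simp only [b_eq i (hs hi)]
    refine ⟨(b, M), ⟨ha.congr fun i hi => (b_eq i (mem_range.2 hi)).symm,
      hMa.trans (nodal_eq _ subset_rfl).symm, fun d x y => ?_⟩, rfl⟩
    have hsub : Ico d N ⊆ range N := fun i hi => mem_range.2 (mem_Ico.1 hi).2
    simpa only [nodal_eq _ hsub] using hnonneg d x y
  · rintro ⟨⟨b, _⟩, ⟨hb, hMb, hnonneg⟩, rfl⟩
    refine ⟨⟨_, hb, hMb, hnonneg⟩, fun z hz => ?_⟩
    rw [hMb, IsRoot, eval_nodal, prod_eq_zero_iff] at hz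
    obtain ⟨i, -, hi⟩ := hz
    exact sub_eq_zero.1 hi ▸ (b i).2

theorem isMicchelliWilloughby_of_mem_closure_reversibleClass {P : Matrix S S ℝ}
    (hP : P ∈ closure (reversibleClass S)) : IsMicchelliWilloughby P := by
  have hclosed := isClosed_setOf_isMicchelliWilloughby_of_bounded (S := S)
    (show (-1 : ℝ) ≤ 1 by norm_num)
  exact (hclosed.closure_subset_iff.2 (fun _ hQ =>
    ⟨isMicchelliWilloughby_of_mem_reversibleClass hQ, fun _ => mem_Icc_of_isRoot_charpoly hQ.1⟩)
    hP).1

lemma eq_drop_of_coe_eq_add {l : List ℝ} (hl : l.Pairwise (· ≥ ·)) {L H : Multiset ℝ}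
    (h : (l : Multiset ℝ) = H + L) (hLH : ∀ x ∈ L, ∀ y ∈ H, x ≤ y) :
    L = ↑(l.drop (Multiset.card H)) := by
  have hsorted : (H.sort (· ≥ ·) ++ L.sort (· ≥ ·)).Pairwise (· ≥ ·) :=
    List.pairwise_append.2 ⟨Multiset.pairwise_sort _ _, Multiset.pairwise_sort _ _,
      fun y hy x hx => hLH x ((Multiset.mem_sort _).1 hx) y ((Multiset.mem_sort _).1 hy)⟩
  have hperm : l.Perm (H.sort (· ≥ ·) ++ L.sort (· ≥ ·)) := by
    rw [← Multiset.coe_eq_coe, ← Multiset.coe_add, Multiset.sort_eq, Multiset.sort_eq, h]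
  rw [hperm.eq_of_pairwise' hl hsorted, List.drop_left' (Multiset.length_sort _), Multiset.sort_eq]

lemma IsMicchelliWilloughby.aeval_prod_nonneg {P : Matrix S S ℝ} (hP : IsMicchelliWilloughby P)
    {L H : Multiset ℝ} (h : P.charpoly = ((H + L).map fun c => X - C c).prod)
    (hLH : ∀ x ∈ L, ∀ y ∈ H, x ≤ y) (x y : S) :
    0 ≤ aeval P (L.map fun c => X - C c).prod x y := by
  obtain ⟨a, ha, hPa, hnonneg⟩ := hP
  set N := Fintype.card S
  have hroots : (((List.range N).map a : List ℝ) : Multiset ℝ) = H + L := by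
    rw [← roots_multiset_prod_X_sub_C (H + L), ← h, hPa, roots_nodal]
    rfl
  have hsorted : ((List.range N).map a).Pairwise (· ≥ ·) :=
    List.pairwise_map.2 <| List.pairwise_lt_range.imp_of_mem fun hi hk hik =>
      ha (List.mem_range.1 hi) (List.mem_range.1 hk) hik.le
  have hL : L = (Ico (Multiset.card H) N).val.map a := by
    rw [eq_drop_of_coe_eq_add hsorted hroots hLH, List.range_eq_range', ← List.map_drop,
      List.drop_range', Nat.Ico_eq_range']
    simp
  rw [hL, Multiset.map_map]
  exact hnonneg _ x y

end ReversibleClass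

section Links

variable {S ι : Type*} [Fintype S] [DecidableEq S] {P : Matrix S S ℝ} {μ π : S → ℝ}
  {β : ι → ℝ}

lemma IsReversible.vecMul_eq (h : IsReversible P π) (hP : P ∈ rowStochastic ℝ S) :
    π ᵥ* P = π := by
  ext y
  simp only [vecMul, dotProduct, h _ y]
  rw [← mul_sum, sum_row_of_mem_rowStochastic hP, mul_one]

lemma vecMul_aeval_of_vecMul_eq_smul {R : Type*} [CommSemiring R] {M : Matrix S S R} {v : S → R}
    {c : R} (h : v ᵥ* M = c • v) (f : R[X]) : v ᵥ* aeval M f = f.eval c • v := by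
  have vecMul_pow : ∀ k : ℕ, v ᵥ* M ^ k = c ^ k • v := fun k => by
    induction k with
    | zero => simp only [pow_zero, vecMul_one, one_smul]
    | succ k ih => rw [pow_succ, ← vecMul_vecMul, ih, smul_vecMul, h, smul_smul, pow_succ]
  induction f using Polynomial.induction_on' with
  | add f g hf hg => rw [map_add, vecMul_add, hf, hg, eval_add, add_smul]
  | monomial k a =>
    rw [aeval_monomial, ← Algebra.smul_def, vecMul_smul, vecMul_pow, eval_monomial, smul_smul]

lemma eq_of_mulVec_eq_self (hP : P ∈ rowStochastic ℝ S)
    (hsimple : P.charpoly.rootMultiplicity 1 = 1) {v : S → ℝ} (hv : P *ᵥ v = v) (x y : S) :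
    v x = v y := by
  let V := Module.End.eigenspace (toLin' P) 1
  have mem_V : ∀ w : S → ℝ, P *ᵥ w = w → w ∈ V := fun w hw => by
    rw [Module.End.mem_eigenspace_iff, toLin'_apply, hw, one_smul]
  have hone : (⟨1, mem_V 1 (one_vecMul_of_mem_rowStochastic hP)⟩ : V) ≠ 0 := fun h =>
    one_ne_zero (congrFun (congrArg Subtype.val h) x)
  have hrank : Module.finrank ℝ V = 1 := by
    refine le_antisymm ?_ (Module.finrank_pos_iff_exists_ne_zero.2 ⟨_, hone⟩)
    simpa only [charpoly_toLin', hsimple] using LinearMap.finrank_eigenspace_le (toLin' P) 1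
  obtain ⟨c, hc⟩ := exists_smul_eq_of_finrank_eq_one hrank hone ⟨v, mem_V v hv⟩
  have v_eq : c • (1 : S → ℝ) = v := congrArg Subtype.val hc
  rw [← v_eq, Pi.smul_apply, Pi.smul_apply, Pi.one_apply, Pi.one_apply]

/-- The signed measure `μ ∏_{j ∈ s} (P - β j) / (1 - β j)`: the conditional law of the chain when
exactly the stages in `s` of the absorbing pure-birth chain with holding probabilities `β j` have
been completed. -/
def linkDist (P : Matrix S S ℝ) (β : ι → ℝ) (μ : S → ℝ) (s : Finset ι) : S → ℝ :=
  (∏ j ∈ s, (1 - β j))⁻¹ • (μ ᵥ* aeval P (nodal s β))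

lemma linkDist_empty (P : Matrix S S ℝ) (β : ι → ℝ) (μ : S → ℝ) : linkDist P β μ ∅ = μ := by
  rw [linkDist, nodal_empty, map_one, vecMul_one, prod_empty, inv_one, one_smul]

lemma linkDist_vecMul [DecidableEq ι] (P : Matrix S S ℝ) (μ : S → ℝ) {s : Finset ι} {i : ι}
    (hi : i ∉ s) (hβ : β i ≠ 1) :
    linkDist P β μ s ᵥ* P = β i • linkDist P β μ s + (1 - β i) • linkDist P β μ (insert i s) := by
  have hcoef : (1 - β i) * (∏ j ∈ insert i s, (1 - β j))⁻¹ = (∏ j ∈ s, (1 - β j))⁻¹ := by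
    rw [prod_insert hi, mul_inv, mul_inv_cancel_left₀ (sub_ne_zero.2 hβ.symm)]
  have hmul : aeval P (nodal (insert i s) β) = aeval P (nodal s β) * (P - β i • 1) := by
    rw [nodal_insert_eq_nodal hi, mul_comm, map_mul, map_sub, aeval_X, aeval_C,
      Algebra.algebraMap_eq_smul_one]
  rw [linkDist, linkDist, smul_smul (1 - β i), hcoef, hmul, ← vecMul_vecMul, vecMul_sub,
    vecMul_smul, vecMul_one, smul_vecMul, smul_sub, smul_comm (β i), add_sub_cancel]

lemma linkDist_nonneg {s : Finset ι} (hμ : ∀ x, 0 ≤ μ x) (hβ : ∀ j ∈ s, β j ≤ 1)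
    (hP : ∀ x y, 0 ≤ aeval P (nodal s β) x y) (x : S) : 0 ≤ linkDist P β μ s x :=
  mul_nonneg (inv_nonneg.2 <| prod_nonneg fun j hj => sub_nonneg.2 (hβ j hj)) <|
    sum_nonneg fun y _ => mul_nonneg (hμ y) (hP y x)

theorem linkDist_nonneg_of_isLowerSet [Fintype ι] [LinearOrder ι] (hP : IsMicchelliWilloughby P)
    (hμ : ∀ x, 0 ≤ μ x) (hβmono : Monotone β) (hβ : ∀ j, β j ≤ 1)
    (hPβ : P.charpoly = (X - C 1) * nodal univ β) {s : Finset ι} (hs : IsLowerSet (s : Set ι)) :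
    0 ≤ linkDist P β μ s := by
  refine linkDist_nonneg hμ (fun j _ => hβ j) ?_
  have hsplit : P.charpoly =
      (((1 ::ₘ sᶜ.val.map β) + s.val.map β).map fun c => X - C c).prod := by
    rw [hPβ, nodal, ← prod_compl_mul_prod s]
    simp
  have hle : ∀ a ∈ s.val.map β, ∀ b ∈ 1 ::ₘ sᶜ.val.map β, a ≤ b := by
    simp only [Multiset.mem_map, Multiset.mem_cons, mem_val, mem_compl]
    rintro _ ⟨j, hj, rfl⟩ _ (rfl | ⟨k, hk, rfl⟩)
    · exact hβ j
    · exact hβmono (le_of_not_ge fun hkj => hk (hs hkj hj))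
  simpa [nodal] using hP.aeval_prod_nonneg hsplit hle

lemma linkDist_of_vecMul_eq {s : Finset ι} (hβ : ∀ j ∈ s, β j ≠ 1) (hπ : π ᵥ* P = π) :
    linkDist P β π s = π := by
  rw [linkDist, vecMul_aeval_of_vecMul_eq_smul (c := 1) (by rwa [one_smul]), eval_nodal, smul_smul,
    inv_mul_cancel₀ (prod_ne_zero_iff.2 fun j hj => sub_ne_zero.2 (hβ j hj).symm), one_smul]

omit [DecidableEq S] in
lemma vecMul_eq_sum_smul {M : Matrix S S ℝ} (hM : ∀ x x' y, M x y = M x' y) (x : S) (μ : S → ℝ) :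
    μ ᵥ* M = (∑ z, μ z) • M x := by
  ext y
  simp only [vecMul, dotProduct, hM _ x y, Pi.smul_apply, smul_eq_mul, sum_mul]

lemma linkDist_congr_sum (hP : P ∈ rowStochastic ℝ S) {s : Finset ι} (hβ : ∀ j ∈ s, β j ≠ 1)
    (hPβ : P.charpoly = (X - C 1) * nodal s β) (hμπ : ∑ x, μ x = ∑ x, π x) :
    linkDist P β μ s = linkDist P β π s := by
  have nodal_eval : (nodal s β).eval 1 ≠ 0 := by
    rw [eval_nodal]
    exact prod_ne_zero_iff.2 fun j hj => sub_ne_zero.2 (hβ j hj).symm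
  have hsimple : P.charpoly.rootMultiplicity 1 = 1 := by
    rw [hPβ, rootMultiplicity_mul (hPβ ▸ (charpoly_monic P).ne_zero),
      rootMultiplicity_X_sub_C_self, rootMultiplicity_eq_zero nodal_eval]
  have mul_aeval : P * aeval P (nodal s β) = aeval P (nodal s β) := by
    have hcayley := aeval_self_charpoly P
    rwa [hPβ, map_mul, map_sub, aeval_X, map_one, map_one, sub_mul, one_mul, sub_eq_zero]
      at hcayley
  have hconst : ∀ x x' y, aeval P (nodal s β) x y = aeval P (nodal s β) x' y := fun x x' y =>
    eq_of_mulVec_eq_self hP hsimple (v := fun z => aeval P (nodal s β) z y)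
      (funext fun z => congrFun₂ mul_aeval z y) x x'
  ext x
  rw [linkDist, linkDist, vecMul_eq_sum_smul hconst x, vecMul_eq_sum_smul hconst x, hμπ]

end Links

section Geometric

variable {Ω S : Type*} [MeasurableSpace Ω] {ρ : Measure Ω} {X Y : Ω → ℕ}

lemma hasSum_measureReal_eq [IsProbabilityMeasure ρ] (hX : Measurable X) :
    HasSum (fun t => ρ.real {ω | X ω = t}) 1 := by
  have htsum : ∑' t, ρ (X ⁻¹' {t}) = 1 := by
    rw [← tsum_univ, tsum_measure_preimage_singleton Set.countable_univ
      fun t _ => hX (measurableSet_singleton t), Set.preimage_univ, measure_univ]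
  simpa only [htsum, ENNReal.toReal_one, ← ENNReal.tsum_toReal_eq fun _ => measure_ne_top _ _]
    using! ENNReal.hasSum_toReal (htsum.trans_ne ENNReal.one_ne_top)

lemma measureReal_le_eq_sum [IsFiniteMeasure ρ] (hX : Measurable X) (t : ℕ) :
    ρ.real {ω | X ω ≤ t} = ∑ s ∈ range (t + 1), ρ.real {ω | X ω = s} := by
  refine (congrArg ρ.real ?_).trans (sum_measureReal_preimage_singleton (range (t + 1))
    fun s _ => hX (measurableSet_singleton s)).symm
  ext ω
  simp

lemma measureReal_lt_eq_one_sub [IsProbabilityMeasure ρ] (hX : Measurable X) (t : ℕ) :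
    ρ.real {ω | t < X ω} = 1 - ρ.real {ω | X ω ≤ t} := by
  refine (congrArg ρ.real ?_).trans (probReal_compl_eq_one_sub (hX measurableSet_Iic))
  ext ω
  simp

lemma measureReal_eq_zero_of_geometric [IsProbabilityMeasure ρ] (hX : Measurable X) {β : ℝ}
    (h0 : 0 ≤ β) (h1 : β < 1) (hlaw : ∀ t : ℕ, ρ.real {ω | X ω = t + 1} = β ^ t * (1 - β)) :
    ρ.real {ω | X ω = 0} = 0 := by
  have hgeom : HasSum (fun t : ℕ => ρ.real {ω | X ω = t + 1}) 1 := by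
    simpa only [hlaw, inv_mul_cancel₀ (sub_pos.2 h1).ne'] using
      (hasSum_geometric_of_lt_one h0 h1).mul_right (1 - β)
  have htotal := (hasSum_nat_add_iff (f := fun t => ρ.real {ω | X ω = t}) 1).1 hgeom
  simpa only [sum_range_one, left_eq_add] using (hasSum_measureReal_eq hX).unique htotal

lemma measureReal_add_le_eq_sum [IsProbabilityMeasure ρ] (hX : Measurable X)
    (hY : Measurable Y) (hXY : IndepFun X Y ρ) (t : ℕ) :
    ρ.real {ω | X ω + Y ω ≤ t} =
      ∑ s ∈ range (t + 1), ρ.real {ω | X ω = s} * ρ.real {ω | Y ω ≤ t - s} := by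
  have hset : {ω | X ω + Y ω ≤ t} =
      ⋃ s ∈ range (t + 1), (X ⁻¹' {s} ∩ Y ⁻¹' Set.Iic (t - s)) := by
    ext ω
    simp only [Set.mem_ofPred_eq, Set.mem_iUnion, mem_range, Set.mem_inter_iff,
      Set.mem_preimage, Set.mem_singleton_iff, Set.mem_Iic, exists_prop]
    exact ⟨fun h => ⟨X ω, by omega⟩, by omega⟩
  rw [hset, measureReal_biUnion_finset]
  · refine sum_congr rfl fun s _ => ?_
    rw [measureReal_def, hXY.measure_inter_preimage_eq_mul _ _ (measurableSet_singleton s)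
      measurableSet_Iic, ENNReal.toReal_mul]
    rfl
  · exact fun s _ s' _ hss => Set.disjoint_left.2 fun ω h h' => hss (h.1.symm.trans h'.1)
  · exact fun s _ => (hX (measurableSet_singleton s)).inter (hY measurableSet_Iic)

/-- Condition on whether the first trial of `X` succeeds. -/
lemma measureReal_add_le_succ_of_geometric [IsProbabilityMeasure ρ] (hX : Measurable X)
    (hY : Measurable Y) (hXY : IndepFun X Y ρ) {β : ℝ} (h0 : 0 ≤ β) (h1 : β < 1)
    (hlaw : ∀ t : ℕ, ρ.real {ω | X ω = t + 1} = β ^ t * (1 - β)) (t : ℕ) :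
    ρ.real {ω | X ω + Y ω ≤ t + 1} =
      β * ρ.real {ω | X ω + Y ω ≤ t} + (1 - β) * ρ.real {ω | Y ω ≤ t} := by
  have hsum : ∀ t, ρ.real {ω | X ω + Y ω ≤ t} =
      ∑ s ∈ range t, β ^ s * (1 - β) * ρ.real {ω | Y ω ≤ t - (s + 1)} := fun t => by
    rw [measureReal_add_le_eq_sum hX hY hXY, sum_range_succ',
      measureReal_eq_zero_of_geometric hX h0 h1 hlaw, zero_mul, add_zero]
    exact sum_congr rfl fun s _ => by rw [hlaw]
  rw [hsum, hsum, sum_range_succ', mul_sum, pow_zero, one_mul]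
  exact congrArg₂ _ (sum_congr rfl fun s _ => by rw [Nat.add_sub_add_right]; ring) (by simp)

variable [Fintype S] [DecidableEq S] {P : Matrix S S ℝ} {μ π : S → ℝ}

lemma measureReal_add_le_smul_le_vecMul_pow [IsProbabilityMeasure ρ] (hX : Measurable X)
    (hY : Measurable Y) (hXY : IndepFun X Y ρ) {β : ℝ} (h0 : 0 ≤ β) (h1 : β < 1)
    (hlaw : ∀ t : ℕ, ρ.real {ω | X ω = t + 1} = β ^ t * (1 - β)) {ν ν' : S → ℝ} (hν : 0 ≤ ν)
    (hνP : ν ᵥ* P = β • ν + (1 - β) • ν')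
    (hν' : ∀ t, ρ.real {ω | Y ω ≤ t} • π ≤ ν' ᵥ* P ^ t) (t : ℕ) :
    ρ.real {ω | X ω + Y ω ≤ t} • π ≤ ν ᵥ* P ^ t := by
  induction t with
  | zero =>
    rw [measureReal_add_le_eq_sum hX hY hXY, sum_range_one,
      measureReal_eq_zero_of_geometric hX h0 h1 hlaw, zero_mul, zero_smul, pow_zero, vecMul_one]
    exact hν
  | succ t ih =>
    rw [measureReal_add_le_succ_of_geometric hX hY hXY h0 h1 hlaw, pow_succ', ← vecMul_vecMul, hνP,
      add_vecMul, smul_vecMul, smul_vecMul, add_smul, mul_smul, mul_smul]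
    exact add_le_add (smul_le_smul_of_nonneg_left ih h0)
      (smul_le_smul_of_nonneg_left (hν' t) (sub_nonneg.2 h1.le))

theorem measureReal_sum_le_smul_le_vecMul_pow {ι : Type*} [Fintype ι] [LinearOrder ι]
    [IsProbabilityMeasure ρ] {τ : ι → Ω → ℕ} (hτ : ∀ j, Measurable (τ j)) (hindep : iIndepFun τ ρ)
    {β : ι → ℝ} (h0 : ∀ j, 0 ≤ β j) (h1 : ∀ j, β j < 1)
    (hlaw : ∀ j (t : ℕ), ρ.real {ω | τ j ω = t + 1} = β j ^ t * (1 - β j))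
    (hnonneg : ∀ s : Finset ι, IsLowerSet (s : Set ι) → 0 ≤ linkDist P β μ s)
    (huniv : linkDist P β μ univ = π) (hπ : π ᵥ* P = π) (t : ℕ) :
    ρ.real {ω | ∑ j, τ j ω ≤ t} • π ≤ μ ᵥ* P ^ t := by
  have pow_stationary : ∀ t, π ᵥ* P ^ t = π := fun t => by
    simpa using vecMul_aeval_of_vecMul_eq_smul (hπ.trans (one_smul ℝ π).symm) (X ^ t)
  have key : ∀ s : Finset ι, IsUpperSet (s : Set ι) → ∀ t,
      ρ.real {ω | ∑ j ∈ s, τ j ω ≤ t} • π ≤ linkDist P β μ sᶜ ᵥ* P ^ t := by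
    intro s
    induction s using Finset.induction_on_min with
    | empty => simp [huniv, pow_stationary]
    | insert i s hi ih =>
      intro hupper
      have hs : IsUpperSet (s : Set ι) := fun j k hjk hj => by
        refine (mem_insert.1 (hupper hjk (mem_insert_of_mem hj))).resolve_left ?_
        exact ((hi j hj).trans_le hjk).ne'
      have his : i ∉ s := fun h => (hi i h).false
      have hstep := linkDist_vecMul P μ (s := (insert i s)ᶜ) (i := i) (by simp) (h1 i).ne
      rw [insert_compl_insert his] at hstep
      simp only [sum_insert his]
      refine measureReal_add_le_smul_le_vecMul_pow (hτ i) ?_ ?_ (h0 i) (h1 i) (hlaw i)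
        (hnonneg _ ?_) hstep (ih hs)
      · fun_prop
      · simpa only [sum_fn] using (hindep.indepFun_finsetSum_of_notMem hτ his).symm
      · rw [coe_compl]
        exact hupper.compl
  simpa [linkDist_empty] using key univ (by simpa using isUpperSet_univ) t

end Geometric

section InhomogeneousChain

variable {Ω E : Type*} [MeasurableSpace Ω] {ρ : Measure Ω}
  {ℱ : Filtration ℕ (inferInstance : MeasurableSpace Ω)} {p : E → ℝ} {K : ℕ → E → E → ℝ}
  {Z : ℕ → Ω → E}

/-- `Z` is a time-inhomogeneous Markov chain relative to the filtration `ℱ`, with initial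
distribution `p` and with `K t` as transition matrix from time `t` to time `t + 1`. -/
structure IsInhomogeneousChain (ρ : Measure Ω)
    (ℱ : Filtration ℕ (inferInstance : MeasurableSpace Ω)) (p : E → ℝ) (K : ℕ → E → E → ℝ)
    (Z : ℕ → Ω → E) : Prop where
  adapted : ∀ t z, MeasurableSet[ℱ t] {ω | Z t ω = z}
  initial : ∀ z, ρ.real {ω | Z 0 ω = z} = p z
  markov : ∀ t z z' A, MeasurableSet[ℱ t] A →
    ρ.real (A ∩ {ω | Z t ω = z ∧ Z (t + 1) ω = z'}) = ρ.real (A ∩ {ω | Z t ω = z}) * K t z z'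

lemma IsInhomogeneousChain.map_equiv {E' : Type*} (hZ : IsInhomogeneousChain ρ ℱ p K Z)
    (e : E ≃ E') :
    IsInhomogeneousChain ρ ℱ (p ∘ e.symm) (fun t z z' => K t (e.symm z) (e.symm z'))
      fun t ω => e (Z t ω) where
  adapted t z := by simpa only [← e.eq_symm_apply] using hZ.adapted t (e.symm z)
  initial z := by simpa only [← e.eq_symm_apply] using! hZ.initial (e.symm z)
  markov t z z' A hA := by
    simpa only [← e.eq_symm_apply] using hZ.markov t (e.symm z) (e.symm z') A hA

lemma IsInhomogeneousChain.measurableSet_setOf [Finite E] (hZ : IsInhomogeneousChain ρ ℱ p K Z)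
    (q : E → Prop) {s t : ℕ} (hst : s ≤ t) : MeasurableSet[ℱ t] {ω | q (Z s ω)} := by
  have hset : {ω | q (Z s ω)} = ⋃ z ∈ {z | q z}, {ω | Z s ω = z} := by
    ext ω
    simp
  rw [hset]
  exact MeasurableSet.biUnion (Set.to_countable _) fun z _ => ℱ.mono hst _ (hZ.adapted s z)

section Construction

variable [Fintype E]

/-- The probability mass function with real weights `p`. -/
def stdSimplexPMF (hp : p ∈ stdSimplex ℝ E) : PMF E :=
  PMF.ofFintype (fun z => ENNReal.ofReal (p z)) <| by
    rw [← ENNReal.ofReal_sum_of_nonneg fun z _ => hp.1 z, hp.2, ENNReal.ofReal_one]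

variable [MeasurableSpace E] [MeasurableSingletonClass E]

lemma stdSimplexPMF_toMeasure_singleton (hp : p ∈ stdSimplex ℝ E) (z : E) :
    (stdSimplexPMF hp).toMeasure {z} = ENNReal.ofReal (p z) := by
  rw [PMF.toMeasure_apply_singleton _ _ (measurableSet_singleton z), stdSimplexPMF,
    PMF.ofFintype_apply]

/-- The kernel `K t`, read as a kernel from the trajectories up to time `t`. -/
def historyKernel (hK : ∀ t z, K t z ∈ stdSimplex ℝ E) (t : ℕ) :
    Kernel ((i : Finset.Iic t) → E) E :=
  Kernel.ofFunOfCountable fun h => (stdSimplexPMF (hK t (h ⟨t, by simp⟩))).toMeasure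

instance (hK : ∀ t z, K t z ∈ stdSimplex ℝ E) (t : ℕ) : IsMarkovKernel (historyKernel hK t) :=
  ⟨fun _ => inferInstanceAs (IsProbabilityMeasure (stdSimplexPMF _).toMeasure)⟩

/-- The law on path space of the chain with initial distribution `p` and kernels `K t`. -/
def pathMeasure (hp : p ∈ stdSimplex ℝ E) (hK : ∀ t z, K t z ∈ stdSimplex ℝ E) :
    Measure (ℕ → E) :=
  Kernel.trajMeasure (X := fun _ => E) (stdSimplexPMF hp).toMeasure (historyKernel hK)

instance (hp : p ∈ stdSimplex ℝ E) (hK : ∀ t z, K t z ∈ stdSimplex ℝ E) :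
    IsProbabilityMeasure (pathMeasure hp hK) := by
  unfold pathMeasure
  infer_instance

variable (hp : p ∈ stdSimplex ℝ E) (hK : ∀ t z, K t z ∈ stdSimplex ℝ E)

lemma pathMeasure_initial (z : E) : (pathMeasure hp hK).real {ω | ω 0 = z} = p z := by
  let ini : E → (i : Finset.Iic 0) → E := (MeasurableEquiv.piUnique fun _ : Finset.Iic 0 => E).symm
  have hini : Measurable ini := MeasurableEquiv.measurable _
  have hmap : (pathMeasure hp hK).map (Preorder.frestrictLe 0) =
      (stdSimplexPMF hp).toMeasure.map ini := by
    rw [pathMeasure, Kernel.trajMeasure, Measure.map_comp _ _ (by fun_prop),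
      Kernel.traj_map_frestrictLe, Kernel.partialTraj_self, Measure.id_comp]
  have hset : MeasurableSet {h : (i : Finset.Iic 0) → E | h ⟨0, by simp⟩ = z} :=
    (Set.toFinite _).measurableSet
  have hpre : ini ⁻¹' {h | h ⟨0, by simp⟩ = z} = {z} := rfl
  have happly := congrArg (fun m : Measure _ => m {h | h ⟨0, by simp⟩ = z}) hmap
  rw [Measure.map_apply (by fun_prop) hset, Measure.map_apply hini hset, hpre,
    stdSimplexPMF_toMeasure_singleton] at happly
  rw [measureReal_def, ← ENNReal.toReal_ofReal (hp.1 z)]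
  exact congrArg ENNReal.toReal happly

lemma pathMeasure_prod_singleton (t : ℕ) (z z' : E) {B : Set ((i : Finset.Iic t) → E)}
    (hB : ∀ h ∈ B, h ⟨t, by simp⟩ = z) :
    pathMeasure hp hK ((fun ω => (Preorder.frestrictLe t ω, ω (t + 1))) ⁻¹' (B ×ˢ {z'})) =
      ENNReal.ofReal (K t z z') * pathMeasure hp hK (Preorder.frestrictLe t ⁻¹' B) := by
  have hBm : MeasurableSet B := (Set.toFinite _).measurableSet
  have hdisintegrate := congrArg (fun m : Measure (((i : Finset.Iic t) → E) × E) => m (B ×ˢ {z'}))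
    (Kernel.map_frestrictLe_trajMeasure_compProd_eq_map_trajMeasure (X := fun _ => E)
      (μ₀ := (stdSimplexPMF hp).toMeasure) (κ := historyKernel hK) (a := t))
  have hkernel : ∀ h ∈ B, historyKernel hK t h {z'} = ENNReal.ofReal (K t z z') := fun h hh => by
    rw [← hB h hh]
    exact stdSimplexPMF_toMeasure_singleton _ z'
  rw [Measure.compProd_apply_prod hBm (measurableSet_singleton z'),
    Measure.map_apply (by fun_prop) (hBm.prod (measurableSet_singleton z')),
    setLIntegral_congr_fun hBm hkernel, setLIntegral_const,
    Measure.map_apply (by fun_prop) hBm] at hdisintegrate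
  exact hdisintegrate.symm

theorem isInhomogeneousChain_pathMeasure :
    IsInhomogeneousChain (pathMeasure hp hK) (Filtration.piLE (X := fun _ : ℕ => E)) p K
      fun t ω => ω t where
  adapted t z := by
    rw [Filtration.piLE_eq_comap_frestrictLe]
    exact ⟨{h | h ⟨t, by simp⟩ = z}, (Set.toFinite _).measurableSet, rfl⟩
  initial := pathMeasure_initial hp hK
  markov t z z' A hA := by
    rw [Filtration.piLE_eq_comap_frestrictLe] at hA
    obtain ⟨B, -, rfl⟩ := hA
    have hnext : Preorder.frestrictLe t ⁻¹' B ∩ {ω : ℕ → E | ω t = z ∧ ω (t + 1) = z'} =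
        (fun ω => (Preorder.frestrictLe t ω, ω (t + 1))) ⁻¹'
          ((B ∩ {h | h ⟨t, by simp⟩ = z}) ×ˢ {z'}) := by
      ext ω
      simp [and_assoc]
    rw [hnext, measureReal_def, pathMeasure_prod_singleton hp hK t z z' fun h hh => hh.2,
      ENNReal.toReal_mul, ENNReal.toReal_ofReal ((hK t z).1 z'), mul_comm]
    rfl

end Construction

theorem exists_isInhomogeneousChain [Fintype E] (hp : p ∈ stdSimplex ℝ E)
    (hK : ∀ t z, K t z ∈ stdSimplex ℝ E) :
    ∃ (Ω : Type) (_ : MeasurableSpace Ω) (ρ : Measure Ω)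
      (ℱ : Filtration ℕ (inferInstance : MeasurableSpace Ω)) (Z : ℕ → Ω → E),
      IsProbabilityMeasure ρ ∧ IsInhomogeneousChain ρ ℱ p K Z := by
  let e := (Fintype.equivFin E).symm
  have hcode : ∀ q ∈ stdSimplex ℝ E, q ∘ e ∈ stdSimplex ℝ (Fin (Fintype.card E)) := fun q hq =>
    ⟨fun i => hq.1 _, (Equiv.sum_comp e q).trans hq.2⟩
  have hK' : ∀ t i, (fun j => K t (e i) (e j)) ∈ stdSimplex ℝ (Fin (Fintype.card E)) := fun t i =>
    hcode _ (hK t (e i))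
  have hZ := (isInhomogeneousChain_pathMeasure (hcode p hp) hK').map_equiv e
  simp only [Function.comp_def, e.apply_symm_apply] at hZ
  exact ⟨_, _, pathMeasure (hcode p hp) hK', _, _, inferInstance, hZ⟩

end InhomogeneousChain

section Restriction

variable {Ω E : Type*} [MeasurableSpace Ω] {ρ : Measure Ω} {G : Set Ω}

/-- The filtration induced on a subspace. -/
def subtypeFiltration (ℱ : Filtration ℕ (inferInstance : MeasurableSpace Ω)) (G : Set Ω) :
    Filtration ℕ (inferInstance : MeasurableSpace G) where
  seq t := (ℱ t).comap Subtype.val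
  mono' _ _ h := MeasurableSpace.comap_mono (ℱ.mono h)
  le' t := MeasurableSpace.comap_mono (ℱ.le t)

lemma measureReal_comap_subtype_preimage (hG : MeasurableSet G) (h0 : ρ Gᶜ = 0) (A : Set Ω) :
    (ρ.comap (Subtype.val : G → Ω)).real (Subtype.val ⁻¹' A) = ρ.real A := by
  rw [measureReal_def, comap_subtype_coe_apply hG, Subtype.image_preimage_coe, Set.inter_comm,
    measure_inter_conull h0, measureReal_def]

lemma isProbabilityMeasure_comap_subtype [IsProbabilityMeasure ρ] (hG : MeasurableSet G)
    (h0 : ρ Gᶜ = 0) : IsProbabilityMeasure (ρ.comap (Subtype.val : G → Ω)) := by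
  refine (MeasurableEmbedding.subtype_coe hG).isProbabilityMeasure_comap ?_
  rwa [Subtype.range_coe]

lemma IsInhomogeneousChain.comap_subtype
    {ℱ : Filtration ℕ (inferInstance : MeasurableSpace Ω)} {p : E → ℝ} {K : ℕ → E → E → ℝ}
    {Z : ℕ → Ω → E} (hZ : IsInhomogeneousChain ρ ℱ p K Z) (hG : MeasurableSet G)
    (h0 : ρ Gᶜ = 0) :
    IsInhomogeneousChain (ρ.comap (Subtype.val : G → Ω)) (subtypeFiltration ℱ G) p K
      fun t ω => Z t ω where
  adapted t z := ⟨_, hZ.adapted t z, rfl⟩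
  initial z := (measureReal_comap_subtype_preimage hG h0 {ω | Z 0 ω = z}).trans (hZ.initial z)
  markov t z z' := by
    rintro _ ⟨A, hA, rfl⟩
    have hmarkov := hZ.markov t z z' A hA
    rwa [← measureReal_comap_subtype_preimage hG h0,
      ← measureReal_comap_subtype_preimage hG h0 (A ∩ {ω | Z t ω = z})] at hmarkov

end Restriction

section MarkedChain

variable {Ω S γ : Type*} [MeasurableSpace Ω] {ρ : Measure Ω}
  {ℱ : Filtration ℕ (inferInstance : MeasurableSpace Ω)} {μ : S → ℝ} {P : Matrix S S ℝ}

/-- The law of a `p`-distributed point `x` together with a mark drawn according to `w x`. -/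
def markedDist (p : S → ℝ) (w : S → γ → ℝ) : S × γ → ℝ :=
  fun z => p z.1 * w z.1 z.2

lemma sum_markedDist [Fintype γ] {w : S → γ → ℝ} (p : S → ℝ) (hw : ∀ x, ∑ c, w x c = 1) (x : S) :
    ∑ c, markedDist p w (x, c) = p x := by
  simp only [markedDist, ← mul_sum, hw, mul_one]

lemma markedDist_mem_stdSimplex [Fintype S] [Fintype γ] {p : S → ℝ} {w : S → γ → ℝ}
    (hp : p ∈ stdSimplex ℝ S) (hw : ∀ x, w x ∈ stdSimplex ℝ γ) :
    markedDist p w ∈ stdSimplex ℝ (S × γ) := by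
  refine ⟨fun z => mul_nonneg (hp.1 _) ((hw _).1 _), ?_⟩
  rw [Fintype.sum_prod_type, ← hp.2]
  exact sum_congr rfl fun x _ => sum_markedDist p (fun x => (hw x).2) x

/-- `Z` is a Markov chain with initial distribution `μ` and transition matrix `P`, carrying at each
time `t` a fresh mark drawn according to `w t x` when the chain is at `x`. -/
def IsMarkedChain (ρ : Measure Ω) (ℱ : Filtration ℕ (inferInstance : MeasurableSpace Ω))
    (μ : S → ℝ) (P : Matrix S S ℝ) (w : ℕ → S → γ → ℝ) (Z : ℕ → Ω → S × γ) : Prop :=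
  IsInhomogeneousChain ρ ℱ (markedDist μ (w 0)) (fun t z => markedDist (P z.1) (w (t + 1))) Z

lemma sum_measureReal_inter_eq {E : Type*} [Fintype E] [IsFiniteMeasure ρ] {g : Ω → E}
    (hg : ∀ z, MeasurableSet {ω | g ω = z}) (A : Set Ω) :
    ∑ z, ρ.real (A ∩ {ω | g ω = z}) = ρ.real A := by
  have hsum := sum_measureReal_preimage_singleton (μ := ρ.restrict A) (f := g) univ fun z _ => hg z
  rw [coe_univ, Set.preimage_univ, measureReal_restrict_apply_univ] at hsum
  rw [← hsum]
  refine sum_congr rfl fun z _ => ?_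
  rw [Set.inter_comm]
  exact (measureReal_restrict_apply (hg z)).symm

theorem IsMarkedChain.isMarkovChain_fst [Finite S] [Fintype γ] [IsFiniteMeasure ρ]
    {w : ℕ → S → γ → ℝ} {Z : ℕ → Ω → S × γ} (hZ : IsMarkedChain ρ ℱ μ P w Z)
    (hw : ∀ t x, ∑ c, w t x c = 1) : IsMarkovChain ρ ℱ μ P fun t ω => (Z t ω).1 where
  adapted t x := hZ.measurableSet_setOf (fun z => z.1 = x) le_rfl
  initial x := by
    have hmark : ∀ c, MeasurableSet {ω | (Z 0 ω).2 = c} := fun c =>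
      ℱ.le 0 _ (hZ.measurableSet_setOf (fun z => z.2 = c) le_rfl)
    rw [← sum_measureReal_inter_eq hmark, ← sum_markedDist μ (hw 0) x]
    refine sum_congr rfl fun c _ => (congrArg ρ.real ?_).trans (hZ.initial (x, c))
    ext ω
    simp [Prod.ext_iff]
  markov t x y A hA := by
    have hmark : ∀ t c, MeasurableSet {ω | (Z t ω).2 = c} := fun t c =>
      ℱ.le t _ (hZ.measurableSet_setOf (fun z => z.2 = c) le_rfl)
    rw [← sum_measureReal_inter_eq (hmark t), ← sum_measureReal_inter_eq (hmark t) (A ∩ _), sum_mul]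
    refine sum_congr rfl fun c _ => ?_
    rw [← sum_measureReal_inter_eq (hmark (t + 1)), ← sum_markedDist (P x) (hw (t + 1)) y, mul_sum]
    have hnow : A ∩ {ω | (Z t ω).1 = x} ∩ {ω | (Z t ω).2 = c} = A ∩ {ω | Z t ω = (x, c)} := by
      ext ω
      simp [Prod.ext_iff, and_assoc]
    refine sum_congr rfl fun d _ => ?_
    rw [hnow, ← hZ.markov t (x, c) (y, d) A hA]
    congr 1
    ext ω
    simp only [Set.mem_inter_iff, Set.mem_ofPred_eq, Prod.ext_iff]
    tauto

end MarkedChain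

section FirstMark

variable {Ω S : Type*} {Z : ℕ → Ω → S × Bool}

/-- The event that no mark `true` occurs strictly before time `t`. -/
def unmarkedBefore (Z : ℕ → Ω → S × Bool) (t : ℕ) : Set Ω :=
  {ω | ∀ s < t, (Z s ω).2 = false}

lemma unmarkedBefore_zero (Z : ℕ → Ω → S × Bool) : unmarkedBefore Z 0 = Set.univ :=
  Set.eq_univ_of_forall fun _ _ hs => absurd hs (Nat.not_lt_zero _)

lemma unmarkedBefore_succ (Z : ℕ → Ω → S × Bool) (t : ℕ) :
    unmarkedBefore Z (t + 1) = unmarkedBefore Z t ∩ {ω | (Z t ω).2 = false} := by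
  ext ω
  exact Nat.forall_lt_succ_right

/-- The first time with mark `true`; it has the junk value `0` where there is none. -/
def firstMark (Z : ℕ → Ω → S × Bool) (ω : Ω) : ℕ :=
  sInf {t | (Z t ω).2 = true}

lemma le_firstMark_iff {ω : Ω} (h : ∃ t, (Z t ω).2 = true) {t : ℕ} :
    t ≤ firstMark Z ω ↔ ω ∈ unmarkedBefore Z t := by
  refine ⟨fun ht s hs => ?_, fun ht => ?_⟩
  · simpa using Nat.notMem_of_lt_sInf (hs.trans_le ht)
  · by_contra! hlt
    have hmem : (Z (firstMark Z ω) ω).2 = true := Nat.sInf_mem h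
    exact Bool.false_ne_true ((ht _ hlt).symm.trans hmem)

lemma firstMark_eq_iff {ω : Ω} (h : ∃ t, (Z t ω).2 = true) {t : ℕ} :
    firstMark Z ω = t ↔ ω ∈ unmarkedBefore Z t ∧ (Z t ω).2 = true := by
  rw [← le_firstMark_iff h]
  refine ⟨?_, fun ⟨hle, ht⟩ => le_antisymm (Nat.sInf_le ht) hle⟩
  rintro rfl
  exact ⟨le_rfl, Nat.sInf_mem h⟩

variable [MeasurableSpace Ω] {ρ : Measure Ω}
  {ℱ : Filtration ℕ (inferInstance : MeasurableSpace Ω)}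

lemma IsInhomogeneousChain.measurableSet_unmarkedBefore [Finite S] {p : S × Bool → ℝ}
    {K : ℕ → S × Bool → S × Bool → ℝ} (hZ : IsInhomogeneousChain ρ ℱ p K Z) {s t : ℕ}
    (hst : s ≤ t + 1) : MeasurableSet[ℱ t] (unmarkedBefore Z s) := by
  simp only [unmarkedBefore, Set.ofPred_forall]
  exact MeasurableSet.iInter fun r => MeasurableSet.iInter fun hr =>
    hZ.measurableSet_setOf (fun z => z.2 = false) (by omega)

lemma IsInhomogeneousChain.isStoppingTime_firstMark [Finite S] {p : S × Bool → ℝ}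
    {K : ℕ → S × Bool → S × Bool → ℝ} (hZ : IsInhomogeneousChain ρ ℱ p K Z)
    (hmark : ∀ ω, ∃ t, (Z t ω).2 = true) :
    IsStoppingTime ℱ fun ω => (firstMark Z ω : WithTop ℕ) := by
  intro t
  convert (hZ.measurableSet_unmarkedBefore (le_refl (t + 1))).compl using 1
  ext ω
  rw [Set.mem_compl_iff, ← le_firstMark_iff (hmark ω), Nat.succ_le_iff, not_lt]
  exact WithTop.coe_le_coe

variable [IsProbabilityMeasure ρ]

theorem IsMarkedChain.measureReal_unmarkedBefore_inter [Fintype S] {μ : S → ℝ} {P : Matrix S S ℝ}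
    {w : ℕ → S → Bool → ℝ} (hZ : IsMarkedChain ρ ℱ μ P w Z) {u : ℕ → S → ℝ} (hu0 : u 0 = μ)
    (hu : ∀ t, u (t + 1) = (fun x => u t x * w t x false) ᵥ* P) (t : ℕ) (x : S) (c : Bool) :
    ρ.real (unmarkedBefore Z t ∩ {ω | Z t ω = (x, c)}) = u t x * w t x c := by
  induction t generalizing x c with
  | zero => rw [unmarkedBefore_zero, Set.univ_inter, hZ.initial, hu0, markedDist]
  | succ t ih =>
    have hstep : ∀ y, ρ.real (unmarkedBefore Z t ∩
        {ω | Z t ω = (y, false) ∧ Z (t + 1) ω = (x, c)}) =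
          u t y * w t y false * P y x * w (t + 1) x c := fun y => by
      rw [hZ.markov t _ _ _ (hZ.measurableSet_unmarkedBefore t.le_succ), ih, markedDist]
      ring
    rw [← sum_measureReal_inter_eq (g := fun ω => (Z t ω).1) fun y =>
      ℱ.le t _ (hZ.measurableSet_setOf (fun z => z.1 = y) le_rfl), hu]
    simp only [vecMul, dotProduct, sum_mul]
    refine sum_congr rfl fun y _ => (congrArg ρ.real ?_).trans (hstep y)
    ext ω
    simp only [unmarkedBefore_succ, Set.mem_inter_iff, Set.mem_ofPred_eq, Prod.ext_iff]
    tauto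

variable {f : ℕ → ℝ} {π : S → ℝ} {p : S × Bool → ℝ} {K : ℕ → S × Bool → S × Bool → ℝ}

lemma IsInhomogeneousChain.measureReal_unmarkedBefore_inter_marked [Fintype S]
    (hZ : IsInhomogeneousChain ρ ℱ p K Z) (hπ : ∑ x, π x = 1)
    (hlaw : ∀ t x, ρ.real (unmarkedBefore Z t ∩ {ω | Z t ω = (x, true)}) = f t * π x) (t : ℕ) :
    ρ.real (unmarkedBefore Z t ∩ {ω | (Z t ω).2 = true}) = f t := by
  rw [← sum_measureReal_inter_eq (g := fun ω => (Z t ω).1) fun x =>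
    ℱ.le t _ (hZ.measurableSet_setOf (fun z => z.1 = x) le_rfl), ← mul_one (f t), ← hπ, mul_sum]
  refine sum_congr rfl fun x _ => (congrArg ρ.real ?_).trans (hlaw t x)
  ext ω
  simp only [Set.mem_inter_iff, Set.mem_ofPred_eq, Prod.ext_iff]
  tauto

lemma IsInhomogeneousChain.measureReal_unmarkedBefore [Finite S]
    (hZ : IsInhomogeneousChain ρ ℱ p K Z)
    (hmass : ∀ t, ρ.real (unmarkedBefore Z t ∩ {ω | (Z t ω).2 = true}) = f t) (t : ℕ) :
    ρ.real (unmarkedBefore Z t) = 1 - ∑ s ∈ range t, f s := by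
  induction t with
  | zero => rw [unmarkedBefore_zero, probReal_univ, sum_range_zero, sub_zero]
  | succ t ih =>
    have hsplit := sum_measureReal_inter_eq (ρ := ρ) (g := fun ω => (Z t ω).2) (fun c =>
      ℱ.le t _ (hZ.measurableSet_setOf (fun z => z.2 = c) le_rfl)) (unmarkedBefore Z t)
    rw [Fintype.sum_bool, hmass, ← unmarkedBefore_succ, ih] at hsplit
    rw [sum_range_succ]
    linarith

lemma IsInhomogeneousChain.measure_compl_marked_eq_zero [Finite S]
    (hZ : IsInhomogeneousChain ρ ℱ p K Z)
    (hmass : ∀ t, ρ.real (unmarkedBefore Z t ∩ {ω | (Z t ω).2 = true}) = f t) (hf : HasSum f 1) :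
    ρ {ω | ∃ t, (Z t ω).2 = true}ᶜ = 0 := by
  have hle : ∀ t, ρ.real {ω | ∃ t, (Z t ω).2 = true}ᶜ ≤ 1 - ∑ s ∈ range t, f s := fun t => by
    rw [← hZ.measureReal_unmarkedBefore hmass]
    exact measureReal_mono fun ω hω s _ => by simpa using not_exists.1 hω s
  have hlim := hf.tendsto_sum_nat.const_sub 1
  rw [sub_self] at hlim
  exact (measureReal_eq_zero_iff).1 (le_antisymm (ge_of_tendsto' hlim hle) measureReal_nonneg)

omit [IsProbabilityMeasure ρ] in
lemma measureReal_firstMark_eq (hmark : ∀ ω, ∃ t, (Z t ω).2 = true)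
    (hmass : ∀ t, ρ.real (unmarkedBefore Z t ∩ {ω | (Z t ω).2 = true}) = f t) (t : ℕ) :
    ρ.real {ω | firstMark Z ω = t} = f t := by
  simp only [firstMark_eq_iff (hmark _), ← hmass]
  rfl

omit [IsProbabilityMeasure ρ] in
theorem IsInhomogeneousChain.isStrongStationaryTime_firstMark [Finite S]
    (hZ : IsInhomogeneousChain ρ ℱ p K Z) (hmark : ∀ ω, ∃ t, (Z t ω).2 = true)
    (hlaw : ∀ t x, ρ.real (unmarkedBefore Z t ∩ {ω | Z t ω = (x, true)}) = f t * π x)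
    (hmass : ∀ t, ρ.real (unmarkedBefore Z t ∩ {ω | (Z t ω).2 = true}) = f t) :
    IsStrongStationaryTime ρ ℱ π (fun t ω => (Z t ω).1) (firstMark Z) where
  stopping := hZ.isStoppingTime_firstMark hmark
  stationary t x := by
    rw [measureReal_firstMark_eq hmark hmass, mul_comm, ← hlaw]
    congr 1
    ext ω
    simp only [Set.mem_inter_iff, Set.mem_ofPred_eq, Prod.ext_iff]
    constructor
    · rintro ⟨hx, ht⟩
      obtain ⟨hbefore, hnow⟩ := (firstMark_eq_iff (hmark ω)).1 ht
      exact ⟨hbefore, ht ▸ hx, hnow⟩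
    · rintro ⟨hbefore, hx, hnow⟩
      have ht := (firstMark_eq_iff (hmark ω)).2 ⟨hbefore, hnow⟩
      exact ⟨ht ▸ hx, ht⟩

end FirstMark

section Domination

variable {S : Type*} [Fintype S] [DecidableEq S] {P : Matrix S S ℝ} {μ π : S → ℝ} {f : ℕ → ℝ}

/-- The law at time `t` of the chain not stopped before `t`, when it is stopped at time `s` with
probability `f s` and with law `π`. -/
def survivingMass (P : Matrix S S ℝ) (μ π : S → ℝ) (f : ℕ → ℝ) (t : ℕ) : S → ℝ :=
  μ ᵥ* P ^ t - (∑ s ∈ range t, f s) • π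

/-- The conditional probabilities, given that the chain is at `x` at time `t` and was not stopped
before, of stopping (mark `true`) and of going on (mark `false`). -/
def stopWeight (P : Matrix S S ℝ) (μ π : S → ℝ) (f : ℕ → ℝ) (t : ℕ) (x : S) : Bool → ℝ
  | true => f t * π x / survivingMass P μ π f t x
  | false => 1 - f t * π x / survivingMass P μ π f t x

lemma mul_le_survivingMass (hdom : ∀ t, (∑ s ∈ range (t + 1), f s) • π ≤ μ ᵥ* P ^ t) (t : ℕ)
    (x : S) : f t * π x ≤ survivingMass P μ π f t x := by
  have hx := hdom t x
  rw [sum_range_succ, add_smul] at hx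
  exact le_sub_iff_add_le'.2 hx

lemma stopWeight_mem_stdSimplex {t : ℕ} {x : S} (h0 : 0 ≤ f t * π x)
    (hle : f t * π x ≤ survivingMass P μ π f t x) :
    stopWeight P μ π f t x ∈ stdSimplex ℝ Bool := by
  refine ⟨?_, by simp [stopWeight]⟩
  rintro (_ | _)
  · exact sub_nonneg.2 (div_le_one_of_le₀ hle (h0.trans hle))
  · exact div_nonneg h0 (h0.trans hle)

lemma survivingMass_mul_stopWeight_true {t : ℕ} {x : S} (h0 : 0 ≤ f t * π x)
    (hle : f t * π x ≤ survivingMass P μ π f t x) :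
    survivingMass P μ π f t x * stopWeight P μ π f t x true = f t * π x :=
  mul_div_cancel_of_imp' fun h => le_antisymm (h ▸ hle) h0

lemma survivingMass_succ (hπ : π ᵥ* P = π) (h0 : ∀ t x, 0 ≤ f t * π x)
    (hle : ∀ t x, f t * π x ≤ survivingMass P μ π f t x) (t : ℕ) :
    survivingMass P μ π f (t + 1) =
      (fun x => survivingMass P μ π f t x * stopWeight P μ π f t x false) ᵥ* P := by
  have hgoing : (fun x => survivingMass P μ π f t x * stopWeight P μ π f t x false) =
      survivingMass P μ π f t - f t • π := by
    ext x
    have htrue := survivingMass_mul_stopWeight_true (h0 t x) (hle t x)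
    simp only [stopWeight, mul_sub, mul_one, Pi.sub_apply, Pi.smul_apply, smul_eq_mul] at htrue ⊢
    rw [htrue]
  rw [hgoing, survivingMass, survivingMass, sub_sub, ← add_smul, ← sum_range_succ, sub_vecMul,
    smul_vecMul, hπ, vecMul_vecMul, ← pow_succ]

lemma IsMarkedChain.measureReal_unmarkedBefore_inter_true {Ω : Type*} [MeasurableSpace Ω]
    {ρ : Measure Ω} [IsProbabilityMeasure ρ]
    {ℱ : Filtration ℕ (inferInstance : MeasurableSpace Ω)} {Z : ℕ → Ω → S × Bool}
    (hZ : IsMarkedChain ρ ℱ μ P (stopWeight P μ π f) Z) (hπ : π ᵥ* P = π)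
    (h0 : ∀ t x, 0 ≤ f t * π x) (hle : ∀ t x, f t * π x ≤ survivingMass P μ π f t x)
    (t : ℕ) (x : S) :
    ρ.real (unmarkedBefore Z t ∩ {ω | Z t ω = (x, true)}) = f t * π x := by
  rw [hZ.measureReal_unmarkedBefore_inter (u := survivingMass P μ π f) (by simp [survivingMass])
    (survivingMass_succ hπ h0 hle), survivingMass_mul_stopWeight_true (h0 t x) (hle t x)]

theorem exists_isMarkedChain_forall_exists_marked (hP : P ∈ rowStochastic ℝ S)
    (hμ : μ ∈ stdSimplex ℝ S) (hπ : π ∈ stdSimplex ℝ S) (hπP : π ᵥ* P = π)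
    (h0 : ∀ t x, 0 ≤ f t * π x) (hle : ∀ t x, f t * π x ≤ survivingMass P μ π f t x)
    (hf : HasSum f 1) :
    ∃ (Ω : Type) (_ : MeasurableSpace Ω) (ρ : Measure Ω)
      (ℱ : Filtration ℕ (inferInstance : MeasurableSpace Ω)) (Z : ℕ → Ω → S × Bool),
      IsProbabilityMeasure ρ ∧ IsMarkedChain ρ ℱ μ P (stopWeight P μ π f) Z ∧
      ∀ ω, ∃ t, (Z t ω).2 = true := by
  have hw : ∀ t x, stopWeight P μ π f t x ∈ stdSimplex ℝ Bool := fun t x =>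
    stopWeight_mem_stdSimplex (h0 t x) (hle t x)
  have hrow : ∀ x, P x ∈ stdSimplex ℝ S := fun x => ⟨hP.1 x, sum_row_of_mem_rowStochastic hP x⟩
  obtain ⟨Ω, _, ρ, ℱ, Z, _, hZ⟩ := exists_isInhomogeneousChain
    (markedDist_mem_stdSimplex hμ (hw 0))
    fun t (z : S × Bool) => markedDist_mem_stdSimplex (hrow z.1) (hw (t + 1))
  -- Marks occur almost surely; restricting to that event makes the first mark finite everywhere.
  let G : Set Ω := {ω | ∃ t, (Z t ω).2 = true}
  have hG : MeasurableSet G := by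
    simp only [G, Set.ofPred_exists]
    exact MeasurableSet.iUnion fun t =>
      ℱ.le t _ (hZ.measurableSet_setOf (fun z => z.2 = true) le_rfl)
  have hG0 : ρ Gᶜ = 0 := by
    have hlaw := IsMarkedChain.measureReal_unmarkedBefore_inter_true hZ hπP h0 hle
    exact hZ.measure_compl_marked_eq_zero
      (hZ.measureReal_unmarkedBefore_inter_marked hπ.2 hlaw) hf
  exact ⟨G, inferInstance, _, _, fun t ω => Z t ω, isProbabilityMeasure_comap_subtype hG hG0,
    hZ.comap_subtype hG hG0, fun ω => ω.2⟩

theorem exists_isStrongStationaryTime_of_smul_le (hP : P ∈ rowStochastic ℝ S)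
    (hμ : μ ∈ stdSimplex ℝ S) (hπ : π ∈ stdSimplex ℝ S) (hπP : π ᵥ* P = π) (hf0 : ∀ t, 0 ≤ f t)
    (hf1 : HasSum f 1) (hdom : ∀ t, (∑ s ∈ range (t + 1), f s) • π ≤ μ ᵥ* P ^ t) :
    ∃ (Ω : Type) (_ : MeasurableSpace Ω) (ρ : Measure Ω)
      (ℱ : Filtration ℕ (inferInstance : MeasurableSpace Ω)) (X : ℕ → Ω → S) (T : Ω → ℕ),
      IsProbabilityMeasure ρ ∧ IsMarkovChain ρ ℱ μ P X ∧ IsStrongStationaryTime ρ ℱ π X T ∧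
      ∀ t : ℕ, ρ.real {ω | T ω = t} = f t := by
  have h0 : ∀ t x, 0 ≤ f t * π x := fun t x => mul_nonneg (hf0 t) (hπ.1 x)
  have hle := mul_le_survivingMass hdom
  obtain ⟨Ω, _, ρ, ℱ, Z, hρ, hZ, hmark⟩ :=
    exists_isMarkedChain_forall_exists_marked hP hμ hπ hπP h0 hle hf1
  have hlaw := hZ.measureReal_unmarkedBefore_inter_true hπP h0 hle
  have hmass := IsInhomogeneousChain.measureReal_unmarkedBefore_inter_marked hZ hπ.2 hlaw
  refine ⟨Ω, _, ρ, ℱ, fun t ω => (Z t ω).1, firstMark Z, hρ, ?_, ?_,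
    measureReal_firstMark_eq hmark hmass⟩
  · exact hZ.isMarkovChain_fst fun t x => (stopWeight_mem_stdSimplex (h0 t x) (hle t x)).2
  · exact IsInhomogeneousChain.isStrongStationaryTime_firstMark hZ hmark hlaw hmass

end Domination

lemma dsep_le_of_smul_le {S : Type*} [Fintype S] {μ π : S → ℝ} (hπ : π ∈ stdSimplex ℝ S) {c : ℝ}
    (h : c • π ≤ μ) : dsep μ π ≤ 1 - c := by
  have : Nonempty {x // π x ≠ 0} := by
    by_contra! hempty
    have hzero : ∀ x, π x = 0 := fun x => not_not.1 fun hx => hempty.false ⟨x, hx⟩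
    simpa [hzero] using hπ.2
  refine ciSup_le fun x => sub_le_sub_left ?_ 1
  rw [le_div_iff₀ ((hπ.1 x).lt_of_ne' x.2)]
  exact h x

end MarkovSep

end

theorem theorem1p4 {S : Type*} [Fintype S] [DecidableEq S]
    -- the state space has `N = n + 1` elements
    (n : ℕ) (hN : Fintype.card S = n + 1)
    (P : Matrix S S ℝ) (hP : P ∈ Matrix.rowStochastic ℝ S)
    (hPcl : P ∈ closure (MarkovSep.reversibleClass S))
    (π : S → ℝ) (hπ : π ∈ stdSimplex ℝ S) (hrev : MarkovSep.IsReversible P π)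
    -- the eigenvalues of `P`, with algebraic multiplicity, are `1` and the `β j`
    (β : Fin n → ℝ) (hβmono : Monotone β) (hβ0 : ∀ j, 0 ≤ β j) (hβ1 : ∀ j, β j < 1)
    (hβ : P.charpoly =
      (Polynomial.X - Polynomial.C 1) * ∏ j, (Polynomial.X - Polynomial.C (β j)))
    -- independent geometric random variables with success probabilities `1 - β j`
    {Ω : Type*} [MeasurableSpace Ω] (ρ : MeasureTheory.Measure Ω)
    [MeasureTheory.IsProbabilityMeasure ρ]
    (τ : Fin n → Ω → ℕ) (hτmeas : ∀ j, Measurable (τ j))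
    (hτindep : ProbabilityTheory.iIndepFun τ ρ)
    (hτlaw : ∀ j (t : ℕ), 1 ≤ t → ρ.real {ω | τ j ω = t} = β j ^ (t - 1) * (1 - β j))
    (μ : S → ℝ) (hμ : μ ∈ stdSimplex ℝ S) :
    (∀ t : ℕ, MarkovSep.dsep (Matrix.vecMul μ (P ^ t)) π ≤ ρ.real {ω | t < ∑ j, τ j ω}) ∧
    ∃ (Ω' : Type) (_ : MeasurableSpace Ω') (ρ' : MeasureTheory.Measure Ω')
      (ℱ : MeasureTheory.Filtration ℕ (inferInstance : MeasurableSpace Ω'))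
      (X : ℕ → Ω' → S) (T : Ω' → ℕ),
      MeasureTheory.IsProbabilityMeasure ρ' ∧
      MarkovSep.IsMarkovChain ρ' ℱ μ P X ∧
      MarkovSep.IsStrongStationaryTime ρ' ℱ π X T ∧
      ∀ t : ℕ, ρ'.real {ω | T ω = t} = ρ.real {ω | ∑ j, τ j ω = t} := by
  have hπP := hrev.vecMul_eq hP
  have hMW := MarkovSep.isMicchelliWilloughby_of_mem_closure_reversibleClass hPcl
  have hβne : ∀ j ∈ Finset.univ, β j ≠ 1 := fun j _ => (hβ1 j).ne
  have habsorbed : MarkovSep.linkDist P β μ Finset.univ = π :=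
    (MarkovSep.linkDist_congr_sum hP hβne hβ (hμ.2.trans hπ.2.symm)).trans
      (MarkovSep.linkDist_of_vecMul_eq hβne hπP)
  have hdom := MarkovSep.measureReal_sum_le_smul_le_vecMul_pow hτmeas hτindep hβ0 hβ1
    (fun j t => hτlaw j (t + 1) le_add_self)
    (fun s => MarkovSep.linkDist_nonneg_of_isLowerSet hMW hμ.1 hβmono (fun j => (hβ1 j).le) hβ)
    habsorbed hπP
  have hsum : Measurable fun ω => ∑ j, τ j ω := by fun_prop
  refine ⟨fun t => ?_, MarkovSep.exists_isStrongStationaryTime_of_smul_le hP hμ hπ hπP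
    (fun _ => measureReal_nonneg) (MarkovSep.hasSum_measureReal_eq hsum) fun t => ?_⟩
  · rw [MarkovSep.measureReal_lt_eq_one_sub hsum]
    exact MarkovSep.dsep_le_of_smul_le hπ (hdom t)
  · rw [← MarkovSep.measureReal_le_eq_sum hsum]
    exact hdom t
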